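/- Let $m\in\mathbb Z$ and $\mu\in\mathbb R$, and let $w$ be a radial vortex profile of degree $m$ and frequency $\mu$, i.e. a nonnegative twice continuously differentiable function on $(0,\infty)$ with $$-w_{rr}-\frac1r w_r+\frac{m^2}{r^2}w+r^2w+2|w|^2w-2\mu w=0\quad(r>0),$$ $w(r)$ bounded as $r\to0^+$ and $w(r)\to0$ as $r\to\infty$. Let $$J=\begin{pmatrix}0&-1\\1&0\end{pmatrix},\qquad R=\begin{pmatrix}1&0\\0&-1\end{pmatrix},$$ and let $(r,\theta)$ be polar coordinates in $\mathbb R^2$. Let $L_c=-\frac12\Delta+\frac12r^2$ be the self-adjoint operator on $L^2(\mathbb R^2,\mathbb C^2)$ associated with the closed quadratic form $$q(\Psi)=\int_{\mathbb R^2}\Big(\tfrac12|\nabla\Psi|^2+\tfrac12r^2|\Psi|^2\Big)dx,\qquad D(q)=H^1(\mathbb R^2,\mathbb C^2)\cap L^2(\mathbb R^2,\mathbb C^2;r^2),$$ that is, $\Psi\in D(L_c)$ and $L_c\Psi=f$ if and only if $\Psi\in D(q)$, $f\in L^2$ and $q(\Phi,\Psi)=\langle\Phi,f\rangle$ for all $\Phi\in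 D(q)$. Let $L_w$ be multiplication by the matrix function $2|w|^2I+|w|^2e^{2m\theta J}R-\mu I$, which is bounded on $L^2(\mathbb R^2,\mathbb C^2)$. Let $A=-J(L_c+L_w)$ with domain $D(A)=D(L_c)$; this is the linearization of $i\psi_t=-\frac12\Delta\psi+\frac12r^2\psi+|\psi|^2\psi$ about the vortex $\psi=e^{-i\mu t}e^{im\theta}w(r)$, in the frame rotating with frequency $\mu$. Then the spectrum of $A$ consists entirely of isolated eigenvalues of finite multiplicity: every $\lambda\in\sigma(A)$ is an isolated point of $\sigma(A)$, is an eigenvalue of $A$, and its spectral projection $\frac1{2\pi i}\oint_{|\zeta-\lambda|=\rho}(\zeta-A)^{-1}d\zeta$ ($\rho>0$ small) has finite-dimensional range. Equivalently, the essential spectrum of $A$ (the complement in $\sigma(A)$ of the set of isolated eigenvalues of finite multiplicity) is empty. -/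

import Mathlib

open MeasureTheory Filter Topology
open scoped SchwartzMap ENNReal LineDeriv ContDiff

noncomputable section

namespace GPVortex

/-! ## Unbounded operators: resolvent set, spectrum, discrete and essential spectrum -/

section Spectrum

variable {H : Type*} [NormedAddCommGroup H] [NormedSpace ℂ H]

/-- `S` is a bounded two-sided inverse of `z - A : D(A) → H`. -/
def IsResolventAt (A : H →ₗ.[ℂ] H) (z : ℂ) (S : H →L[ℂ] H) : Prop :=
  (∀ f : H, ∃ u : A.domain, (u : H) = S f ∧ z • (u : H) - A u = f) ∧
    ∀ u : A.domain, S (z • (u : H) - A u) = u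

/-- The resolvent set `ρ(A)` of an unbounded operator. -/
def resolventSet (A : H →ₗ.[ℂ] H) : Set ℂ := {z | ∃ S : H →L[ℂ] H, IsResolventAt A z S}

/-- The spectrum `σ(A) = ℂ \ ρ(A)` of an unbounded operator. -/
def spectrum (A : H →ₗ.[ℂ] H) : Set ℂ := (resolventSet A)ᶜ

theorem IsResolventAt.unique {A : H →ₗ.[ℂ] H} {z : ℂ} {S T : H →L[ℂ] H}
    (hS : IsResolventAt A z S) (hT : IsResolventAt A z T) : S = T := by
  ext f
  obtain ⟨u, hu, huf⟩ := hS.1 f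
  have := hT.2 u
  rw [huf] at this
  rw [← hu, this]

open Classical in
/-- The resolvent `(z - A)⁻¹` for `z ∈ ρ(A)` (and `0` for `z ∈ σ(A)`). -/
def resolvent (A : H →ₗ.[ℂ] H) (z : ℂ) : H →L[ℂ] H :=
  if h : ∃ S : H →L[ℂ] H, IsResolventAt A z S then h.choose else 0

theorem isResolventAt_resolvent {A : H →ₗ.[ℂ] H} {z : ℂ} (hz : z ∈ resolventSet A) :
    IsResolventAt A z (resolvent A z) := by
  have h : ∃ S : H →L[ℂ] H, IsResolventAt A z S := hz
  rw [resolvent, dif_pos h]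
  exact h.choose_spec

/-- `z` is an isolated point of the spectrum of `A`. -/
def IsIsolatedInSpectrum (A : H →ₗ.[ℂ] H) (z : ℂ) : Prop :=
  z ∈ spectrum A ∧ ∀ᶠ ζ in 𝓝[≠] z, ζ ∈ resolventSet A

/-- `z` is an eigenvalue of `A`. -/
def IsEigenvalue (A : H →ₗ.[ℂ] H) (z : ℂ) : Prop :=
  ∃ u : A.domain, (u : H) ≠ 0 ∧ A u = z • (u : H)

/-- The Riesz integral `(2πi)⁻¹ ∮_{|ζ - z| = r} (ζ - A)⁻¹ dζ`. For an isolated point `z` of the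
spectrum and small `r` this is the spectral projection of `A` at `z`. -/
def rieszProjection (A : H →ₗ.[ℂ] H) (z : ℂ) (r : ℝ) : H →L[ℂ] H :=
  (2 * Real.pi * Complex.I : ℂ)⁻¹ • ∮ ζ in C(z, r), resolvent A ζ

/-- The isolated spectral point `z` has finite (algebraic) multiplicity: the range of the spectral
projection at `z` is finite-dimensional. -/
def HasFiniteMultiplicity (A : H →ₗ.[ℂ] H) (z : ℂ) : Prop :=
  ∀ᶠ r in 𝓝[>] (0 : ℝ), FiniteDimensional ℂ (rieszProjection A z r).range

/-- The discrete spectrum: isolated eigenvalues of finite multiplicity. -/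
def discreteSpectrum (A : H →ₗ.[ℂ] H) : Set ℂ :=
  {z | IsIsolatedInSpectrum A z ∧ IsEigenvalue A z ∧ HasFiniteMultiplicity A z}

/-- The essential spectrum: the part of the spectrum that is not discrete. -/
def essentialSpectrum (A : H →ₗ.[ℂ] H) : Set ℂ := spectrum A \ discreteSpectrum A

end Spectrum

/-! ## The space `L²(ℝ², ℂ²)` and weak derivatives -/

/-- The plane `ℝ²`. -/
abbrev Plane : Type := EuclideanSpace ℝ (Fin 2)

/-- The Hermitian space `ℂ²`. -/
abbrev Pair : Type := EuclideanSpace ℂ (Fin 2)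

/-- `L²(ℝ², ℂ²)`. -/
abbrev L2 : Type := Lp Pair 2 (volume : Measure Plane)

/-- The graph of the weak derivative `∂ᵢ` in `L²`: pairs `(Ψ, g)` of `L²` functions with
`∂ᵢ Ψ = g` in the sense of (tempered) distributions. -/
def weakPartialGraph (i : Fin 2) : Submodule ℂ (L2 × L2) where
  carrier := {p | ∂_{(EuclideanSpace.single i (1 : ℝ) : Plane)}
      (Lp.toTemperedDistributionCLM Pair (volume : Measure Plane) 2 p.1) =
    Lp.toTemperedDistributionCLM Pair (volume : Measure Plane) 2 p.2}
  add_mem' {p q} hp hq := by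
    simp only [Set.mem_ofPred_eq, Prod.fst_add, Prod.snd_add, map_add,
      LineDeriv.lineDerivOp_add] at *
    rw [hp, hq]
  zero_mem' := by
    simp only [Set.mem_ofPred_eq, Prod.fst_zero, Prod.snd_zero, map_zero,
      LineDeriv.lineDerivOp_zero]
  smul_mem' c p hp := by
    simp only [Set.mem_ofPred_eq, Prod.smul_fst, Prod.smul_snd, map_smul,
      LineDeriv.lineDerivOp_smul] at *
    rw [hp]

theorem mem_weakPartialGraph {i : Fin 2} {p : L2 × L2} : p ∈ weakPartialGraph i ↔
    ∂_{(EuclideanSpace.single i (1 : ℝ) : Plane)}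
      (Lp.toTemperedDistributionCLM Pair (volume : Measure Plane) 2 p.1) =
    Lp.toTemperedDistributionCLM Pair (volume : Measure Plane) 2 p.2 := Iff.rfl

theorem weakPartialGraph_functional (i : Fin 2) (p : L2 × L2) (hp : p ∈ weakPartialGraph i)
    (h0 : p.1 = 0) : p.2 = 0 := by
  have h : ∂_{(EuclideanSpace.single i (1 : ℝ) : Plane)}
      (Lp.toTemperedDistributionCLM Pair (volume : Measure Plane) 2 p.1) =
    Lp.toTemperedDistributionCLM Pair (volume : Measure Plane) 2 p.2 := hp
  rw [h0, map_zero, LineDeriv.lineDerivOp_zero] at h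
  have hk : p.2 ∈ (Lp.toTemperedDistributionCLM Pair (volume : Measure Plane) 2).ker := h.symm
  rw [Lp.ker_toTemperedDistributionCLM_eq_bot] at hk
  simpa using hk

/-- The weak derivative `∂ᵢ` on its maximal domain in `L²(ℝ², ℂ²)`;
`H¹ = D(∂₀) ∩ D(∂₁)`. -/
def weakPartial (i : Fin 2) : L2 →ₗ.[ℂ] L2 := (weakPartialGraph i).toLinearPMap

theorem weakPartial_graph (i : Fin 2) : (weakPartial i).graph = weakPartialGraph i :=
  Submodule.toLinearPMap_graph_eq _ (weakPartialGraph_functional i)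

/-- The pointwise product `x ↦ M(x) Ψ(x)`. -/
def mulFun (M : Plane → Matrix (Fin 2) (Fin 2) ℂ) (Ψ : L2) (x : Plane) : Pair :=
  Matrix.toEuclideanCLM (𝕜 := ℂ) (M x) (Ψ x)

theorem mulFun_add (M : Plane → Matrix (Fin 2) (Fin 2) ℂ) (Ψ Φ : L2) :
    mulFun M (Ψ + Φ) =ᵐ[volume] mulFun M Ψ + mulFun M Φ := by
  filter_upwards [Lp.coeFn_add Ψ Φ] with x hx
  simp only [mulFun, Pi.add_apply]
  rw [hx, Pi.add_apply, map_add]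

theorem mulFun_smul (M : Plane → Matrix (Fin 2) (Fin 2) ℂ) (c : ℂ) (Ψ : L2) :
    mulFun M (c • Ψ) =ᵐ[volume] c • mulFun M Ψ := by
  filter_upwards [Lp.coeFn_smul c Ψ] with x hx
  simp only [mulFun, Pi.smul_apply]
  rw [hx, Pi.smul_apply, map_smul]

/-- The maximal domain `{Ψ ∈ L² : M Ψ ∈ L²}` of a multiplication operator. -/
def mulDomain (M : Plane → Matrix (Fin 2) (Fin 2) ℂ) : Submodule ℂ L2 where
  carrier := {Ψ | MemLp (mulFun M Ψ) 2 volume}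
  add_mem' {Ψ Φ} hΨ hΦ := (MemLp.add hΨ hΦ).ae_eq (mulFun_add M Ψ Φ).symm
  zero_mem' := by
    have h := mulFun_smul M 0 0
    rw [zero_smul, zero_smul] at h
    exact MemLp.zero.ae_eq h.symm
  smul_mem' c Ψ hΨ := (MemLp.const_smul hΨ c).ae_eq (mulFun_smul M c Ψ).symm

theorem mem_mulDomain {M : Plane → Matrix (Fin 2) (Fin 2) ℂ} {Ψ : L2} :
    Ψ ∈ mulDomain M ↔ MemLp (mulFun M Ψ) 2 volume := Iff.rfl

/-- Multiplication `Ψ ↦ M Ψ` by a matrix-valued function, on its maximal domain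
`{Ψ ∈ L² : M Ψ ∈ L²}`. -/
def mulOp (M : Plane → Matrix (Fin 2) (Fin 2) ℂ) : L2 →ₗ.[ℂ] L2 where
  domain := mulDomain M
  toFun :=
    { toFun := fun Ψ => MemLp.toLp (mulFun M Ψ) (mem_mulDomain.1 Ψ.2)
      map_add' := fun Ψ Φ => by
        refine (MemLp.toLp_congr _ ?_ (mulFun_add M Ψ Φ)).trans (MemLp.toLp_add _ _)
        exact (mem_mulDomain.1 Ψ.2).add (mem_mulDomain.1 Φ.2)
      map_smul' := fun c Ψ => by
        refine (MemLp.toLp_congr _ ?_ (mulFun_smul M c Ψ)).trans (MemLp.toLp_const_smul c _)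
        exact (mem_mulDomain.1 Ψ.2).const_smul c }

/-- Multiplication by `r = |x|`; its domain is `L²(ℝ², ℂ²) ∩ L²(ℝ², ℂ²; r²)`. -/
def radiusOp : L2 →ₗ.[ℂ] L2 := mulOp fun x => (‖x‖ : ℂ) • 1

/-! ## The quadratic form and the operator `L_c` -/

/-- The form domain `D(q) = H¹ ∩ L²(r²)`. -/
def formDomain : Submodule ℂ L2 :=
  (weakPartial 0).domain ⊓ (weakPartial 1).domain ⊓ radiusOp.domain

/-- The sesquilinear form (conjugate-linear in the first variable) on `D(q)`
`q(Φ, Ψ) = ½ ∫ ∇Φ̄ · ∇Ψ + ½ ∫ r² Φ̄ · Ψ`. -/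
def formQ (Φ Ψ : formDomain) : ℂ :=
  (1 / 2) * (inner ℂ (weakPartial 0 ⟨Φ, Φ.2.1.1⟩) (weakPartial 0 ⟨Ψ, Ψ.2.1.1⟩) +
      inner ℂ (weakPartial 1 ⟨Φ, Φ.2.1.2⟩) (weakPartial 1 ⟨Ψ, Ψ.2.1.2⟩)) +
    (1 / 2) * inner ℂ (radiusOp ⟨Φ, Φ.2.2⟩) (radiusOp ⟨Ψ, Ψ.2.2⟩)

theorem formQ_add_right (Φ Ψ Ψ' : formDomain) :
    formQ Φ (Ψ + Ψ') = formQ Φ Ψ + formQ Φ Ψ' := by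
  have h0 : weakPartial 0 ⟨((Ψ + Ψ' : formDomain) : L2), (Ψ + Ψ').2.1.1⟩ =
      weakPartial 0 ⟨Ψ, Ψ.2.1.1⟩ + weakPartial 0 ⟨Ψ', Ψ'.2.1.1⟩ :=
    (weakPartial 0).map_add ⟨Ψ, Ψ.2.1.1⟩ ⟨Ψ', Ψ'.2.1.1⟩
  have h1 : weakPartial 1 ⟨((Ψ + Ψ' : formDomain) : L2), (Ψ + Ψ').2.1.2⟩ =
      weakPartial 1 ⟨Ψ, Ψ.2.1.2⟩ + weakPartial 1 ⟨Ψ', Ψ'.2.1.2⟩ :=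
    (weakPartial 1).map_add ⟨Ψ, Ψ.2.1.2⟩ ⟨Ψ', Ψ'.2.1.2⟩
  have h2 : radiusOp ⟨((Ψ + Ψ' : formDomain) : L2), (Ψ + Ψ').2.2⟩ =
      radiusOp ⟨Ψ, Ψ.2.2⟩ + radiusOp ⟨Ψ', Ψ'.2.2⟩ :=
    radiusOp.map_add ⟨Ψ, Ψ.2.2⟩ ⟨Ψ', Ψ'.2.2⟩
  simp only [formQ, h0, h1, h2, inner_add_right]
  ring

theorem formQ_smul_right (c : ℂ) (Φ Ψ : formDomain) :
    formQ Φ (c • Ψ) = c * formQ Φ Ψ := by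
  have h0 : weakPartial 0 ⟨((c • Ψ : formDomain) : L2), (c • Ψ).2.1.1⟩ =
      c • weakPartial 0 ⟨Ψ, Ψ.2.1.1⟩ :=
    (weakPartial 0).map_smul c ⟨Ψ, Ψ.2.1.1⟩
  have h1 : weakPartial 1 ⟨((c • Ψ : formDomain) : L2), (c • Ψ).2.1.2⟩ =
      c • weakPartial 1 ⟨Ψ, Ψ.2.1.2⟩ :=
    (weakPartial 1).map_smul c ⟨Ψ, Ψ.2.1.2⟩
  have h2 : radiusOp ⟨((c • Ψ : formDomain) : L2), (c • Ψ).2.2⟩ = c • radiusOp ⟨Ψ, Ψ.2.2⟩ :=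
    radiusOp.map_smul c ⟨Ψ, Ψ.2.2⟩
  simp only [formQ, h0, h1, h2, inner_smul_right]
  ring

/-- The graph of the operator associated with the form `q`: pairs `(Ψ, f)` with `Ψ ∈ D(q)` and
`q(Φ, Ψ) = ⟨Φ, f⟩` for all `Φ ∈ D(q)`. -/
def LcGraph : Submodule ℂ (L2 × L2) where
  carrier := {p | ∃ Ψ : formDomain, (Ψ : L2) = p.1 ∧
    ∀ Φ : formDomain, formQ Φ Ψ = inner ℂ (Φ : L2) p.2}
  add_mem' := by
    rintro p p' ⟨Ψ, hΨ, h⟩ ⟨Ψ', hΨ', h'⟩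
    exact ⟨Ψ + Ψ', by simp [hΨ, hΨ'], fun Φ => by
      rw [formQ_add_right, h, h', Prod.snd_add, inner_add_right]⟩
  zero_mem' := ⟨0, rfl, fun Φ => by
    have := formQ_smul_right 0 Φ 0
    simpa using this⟩
  smul_mem' := by
    rintro c p ⟨Ψ, hΨ, h⟩
    exact ⟨c • Ψ, by simp [hΨ], fun Φ => by
      rw [formQ_smul_right, h, Prod.smul_snd, inner_smul_right]⟩

theorem schwartz_mem_weakPartial (i : Fin 2) (f : 𝓢(Plane, Pair)) :
    SchwartzMap.toLpCLM ℂ Pair 2 (volume : Measure Plane) f ∈ (weakPartial i).domain := by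
  have h : (SchwartzMap.toLpCLM ℂ Pair 2 (volume : Measure Plane) f,
      SchwartzMap.toLpCLM ℂ Pair 2 (volume : Measure Plane)
        (∂_{(EuclideanSpace.single i (1 : ℝ) : Plane)} f)) ∈ (weakPartial i).graph := by
    rw [weakPartial_graph, mem_weakPartialGraph]
    simp only [SchwartzMap.toLpCLM_apply, Lp.toTemperedDistributionCLM_apply,
      Lp.toTemperedDistribution_toLp_eq]
    exact TemperedDistribution.lineDerivOp_toTemperedDistributionCLM_eq f _
  exact LinearPMap.mem_domain_of_mem_graph h

theorem schwartz_mem_radiusOp (f : 𝓢(Plane, Pair)) :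
    SchwartzMap.toLpCLM ℂ Pair 2 (volume : Measure Plane) f ∈ radiusOp.domain := by
  have hc : MemLp (fun x : Plane => (‖x‖ : ℂ) • f x) 2 volume := by
    have hm : AEStronglyMeasurable (fun x : Plane => (‖x‖ : ℂ) • f x) volume :=
      ((Complex.continuous_ofReal.comp continuous_norm).smul f.continuous).aestronglyMeasurable
    rw [memLp_two_iff_integrable_sq_norm hm]
    obtain ⟨C, -, hC⟩ := f.decay 0 0
    refine ((f.integrable_pow_mul volume 2).const_mul C).mono (hm.norm.pow 2)
      (Eventually.of_forall fun x => ?_)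
    have h1 : ‖f x‖ ≤ C := by simpa using hC x
    have h2 : 0 ≤ C := (norm_nonneg _).trans h1
    rw [Real.norm_of_nonneg (by positivity), Real.norm_of_nonneg (by positivity), norm_smul,
      Complex.norm_real, norm_norm, mul_pow]
    calc ‖x‖ ^ 2 * ‖f x‖ ^ 2 = ‖f x‖ * (‖x‖ ^ 2 * ‖f x‖) := by ring
      _ ≤ C * (‖x‖ ^ 2 * ‖f x‖) := by gcongr
  refine hc.ae_eq ?_
  filter_upwards [f.coeFn_toLp 2 (volume : Measure Plane)] with x hx
  simp only [mulFun, SchwartzMap.toLpCLM_apply]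
  rw [hx, map_smul, map_one]
  rfl

theorem formDomain_dense : Dense (formDomain : Set L2) := by
  have h : DenseRange (SchwartzMap.toLpCLM ℂ Pair 2 (volume : Measure Plane)) :=
    SchwartzMap.denseRange_toLpCLM ENNReal.ofNat_ne_top
  refine h.mono ?_
  rintro _ ⟨f, rfl⟩
  exact ⟨⟨schwartz_mem_weakPartial 0 f, schwartz_mem_weakPartial 1 f⟩, schwartz_mem_radiusOp f⟩

theorem LcGraph_functional (p : L2 × L2) (hp : p ∈ LcGraph) (h0 : p.1 = 0) : p.2 = 0 := by
  obtain ⟨Ψ, hΨ, h⟩ := hp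
  have hΨ0 : Ψ = 0 := Subtype.ext (hΨ.trans h0)
  have hz : ∀ Φ : formDomain, inner ℂ (Φ : L2) p.2 = 0 := by
    intro Φ
    have := formQ_smul_right 0 Φ 0
    rw [← h, hΨ0]
    simpa using this
  exact formDomain_dense.eq_zero_of_inner_right ℂ (fun v hv => hz ⟨v, hv⟩)

/-- The self-adjoint operator `L_c = -½ Δ + ½ r²` of the form `q`. -/
def Lc : L2 →ₗ.[ℂ] L2 := LcGraph.toLinearPMap

theorem Lc_graph : Lc.graph = LcGraph :=
  Submodule.toLinearPMap_graph_eq _ LcGraph_functional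

/-! ## Vortex profiles and the linearized operator -/

/-- A radial vortex profile of degree `m` and frequency `μ`: a nonnegative, twice continuously
differentiable solution on `r > 0` of
`-w'' - w'/r + (m²/r²) w + r² w + 2 |w|² w - 2 μ w = 0`,
bounded as `r → 0⁺` and tending to `0` as `r → ∞`. -/
structure IsVortexProfile (m : ℤ) (μ : ℝ) (w : ℝ → ℝ) : Prop where
  contDiffOn : ContDiffOn ℝ 2 w (Set.Ioi 0)
  ode : ∀ r : ℝ, 0 < r →
    -deriv (deriv w) r - 1 / r * deriv w r + (m : ℝ) ^ 2 / r ^ 2 * w r + r ^ 2 * w r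
      + 2 * |w r| ^ 2 * w r - 2 * μ * w r = 0
  nonneg : ∀ r : ℝ, 0 < r → 0 ≤ w r
  bounded_zero : ∃ C : ℝ, ∀ᶠ r in 𝓝[>] (0 : ℝ), |w r| ≤ C
  tendsto_atTop : Tendsto w atTop (𝓝 0)

/-- The matrix `J`. -/
def J : Matrix (Fin 2) (Fin 2) ℂ := !![0, -1; 1, 0]

/-- The matrix `R`. -/
def R : Matrix (Fin 2) (Fin 2) ℂ := !![1, 0; 0, -1]

/-- The rotation matrix `e^{αJ} = (cos α) I + (sin α) J` (recall `J² = -I`). -/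
def expJ (α : ℝ) : Matrix (Fin 2) (Fin 2) ℂ := (Real.cos α : ℂ) • 1 + (Real.sin α : ℂ) • J

/-- The polar angle `θ` of a point of the plane. -/
def polarAngle (x : Plane) : ℝ := Complex.arg ⟨x 0, x 1⟩

/-- The matrix-valued potential `2|w|² I + |w|² e^{2mθJ} R - μ I` with `w = w(r)`. -/
def LwPotential (m : ℤ) (μ : ℝ) (w : ℝ → ℝ) (x : Plane) : Matrix (Fin 2) (Fin 2) ℂ :=
  (2 * |w ‖x‖| ^ 2 : ℂ) • 1 + (|w ‖x‖| ^ 2 : ℂ) • (expJ (2 * m * polarAngle x) * R) -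
    (μ : ℂ) • 1

/-- Multiplication by the potential `2|w|² I + |w|² e^{2mθJ} R - μ I`
(everywhere defined on `L²` when `w` is a vortex profile, see `Lw_domain`). -/
def Lw (m : ℤ) (μ : ℝ) (w : ℝ → ℝ) : L2 →ₗ.[ℂ] L2 := mulOp (LwPotential m μ w)

/-- Multiplication by the constant matrix `J`. -/
def opJ : L2 →L[ℂ] L2 := (Matrix.toEuclideanCLM (𝕜 := ℂ) J).compLpL 2 volume

/-- The linearized operator `A = -J (L_c + L_w)` on `D(L_c) ∩ D(L_w)`, which equals `D(L_c)` when
`w` is a vortex profile, see `linearization_domain`. -/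
def linearization (m : ℤ) (μ : ℝ) (w : ℝ → ℝ) : L2 →ₗ.[ℂ] L2 :=
  (-opJ : L2 →L[ℂ] L2).toLinearMap.compPMap (Lc + Lw m μ w)

theorem IsVortexProfile.exists_bound {m : ℤ} {μ : ℝ} {w : ℝ → ℝ} (hw : IsVortexProfile m μ w) :
    ∃ C : ℝ, ∀ r : ℝ, 0 < r → |w r| ≤ C := by
  obtain ⟨C₀, h₀⟩ := hw.bounded_zero
  obtain ⟨a, ha, h₀⟩ := (mem_nhdsGT_iff_exists_Ioo_subset (a := (0 : ℝ))).1 h₀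
  have h₁ := hw.tendsto_atTop.abs.eventually (gt_mem_nhds (show |(0 : ℝ)| < 1 by simp))
  obtain ⟨b, h₁⟩ := eventually_atTop.1 h₁
  have hs : Set.Icc a b ⊆ Set.Ioi 0 := fun x hx => lt_of_lt_of_le ha hx.1
  obtain ⟨C₂, h₂⟩ := (isCompact_Icc (a := a) (b := b)).exists_bound_of_continuousOn
    (hw.contDiffOn.continuousOn.mono hs)
  refine ⟨max C₀ (max 1 C₂), fun r hr => ?_⟩
  rcases lt_or_ge r a with h | h
  · exact (h₀ ⟨hr, h⟩).trans (le_max_left _ _)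
  rcases le_or_gt b r with h' | h'
  · exact (h₁ r h').le.trans ((le_max_left _ _).trans (le_max_right _ _))
  · exact (h₂ r ⟨h, h'.le⟩).trans ((le_max_right _ _).trans (le_max_right _ _))

theorem IsVortexProfile.aemeasurable {m : ℤ} {μ : ℝ} {w : ℝ → ℝ} (hw : IsVortexProfile m μ w) :
    AEMeasurable (fun x : Plane => w ‖x‖) volume := by
  have h : Measurable (Set.indicator (Set.Ioi 0) w) :=
    hw.contDiffOn.continuousOn.measurable_piecewise continuousOn_const measurableSet_Ioi
  refine ⟨fun x => Set.indicator (Set.Ioi 0) w ‖x‖, h.comp measurable_norm, ?_⟩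
  filter_upwards [Measure.ae_ne volume (0 : Plane)] with x hx
  simp [hx]

theorem measurable_polarAngle : Measurable polarAngle := by
  have h : polarAngle = fun x : Plane => Complex.arg ((x 0 : ℂ) + (x 1 : ℂ) * Complex.I) := by
    funext x
    rw [polarAngle, Complex.mk_eq_add_mul_I]
  rw [h]
  fun_prop

theorem memLp_smul_of_bound {c : Plane → ℝ} {v : Plane → Pair} (hc : AEMeasurable c volume)
    {C : ℝ} (hC : ∀ᵐ x, |c x| ≤ C) (hv : MemLp v 2 volume) :
    MemLp (fun x => (c x : ℂ) • v x) 2 volume := by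
  have hm : AEStronglyMeasurable (fun x => (c x : ℂ)) volume :=
    (Complex.measurable_ofReal.comp_aemeasurable hc).aestronglyMeasurable
  refine hv.of_le_mul (c := C) (hm.smul hv.1) ?_
  filter_upwards [hC] with x hx
  rw [norm_smul, Complex.norm_real, Real.norm_eq_abs]
  gcongr

theorem mulFun_LwPotential (m : ℤ) (μ : ℝ) (w : ℝ → ℝ) (Ψ : L2) (x : Plane) :
    mulFun (LwPotential m μ w) Ψ x = ((2 * |w ‖x‖| ^ 2 : ℝ) : ℂ) • Ψ x +
        ((|w ‖x‖| ^ 2 : ℝ) : ℂ) • ((Real.cos (2 * m * polarAngle x) : ℂ) •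
            Matrix.toEuclideanCLM (𝕜 := ℂ) R (Ψ x) +
          (Real.sin (2 * m * polarAngle x) : ℂ) •
            Matrix.toEuclideanCLM (𝕜 := ℂ) (J * R) (Ψ x)) - (μ : ℂ) • Ψ x := by
  rw [mulFun, LwPotential, expJ, add_mul, smul_mul_assoc, smul_mul_assoc, one_mul, map_sub,
    map_add, map_smul, map_smul, map_smul, map_add, map_smul, map_smul, map_one]
  push_cast
  rfl

theorem Lw_domain {m : ℤ} {μ : ℝ} {w : ℝ → ℝ} (hw : IsVortexProfile m μ w) :
    (Lw m μ w).domain = ⊤ := by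
  refine eq_top_iff.2 fun Ψ _ => ?_
  obtain ⟨C, hC⟩ := hw.exists_bound
  have hv : MemLp (Ψ : Plane → Pair) 2 volume := Lp.memLp Ψ
  have hT : ∀ T : Pair →L[ℂ] Pair, MemLp (fun x => T (Ψ x)) 2 volume := fun T => T.comp_memLp' hv
  have hw2 : AEMeasurable (fun x : Plane => |w ‖x‖| ^ 2) volume := hw.aemeasurable.abs.pow_const 2
  have hb : ∀ᵐ x : Plane, |(|w ‖x‖| ^ 2)| ≤ C ^ 2 := by
    filter_upwards [Measure.ae_ne volume (0 : Plane)] with x hx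
    rw [abs_of_nonneg (by positivity)]
    gcongr
    exact hC _ (norm_pos_iff.2 hx)
  have hb2 : ∀ᵐ x : Plane, |2 * |w ‖x‖| ^ 2| ≤ 2 * C ^ 2 := by
    filter_upwards [hb] with x hx
    rw [abs_mul, abs_two]
    gcongr
  have hθ : Measurable fun x : Plane => 2 * (m : ℝ) * polarAngle x :=
    measurable_polarAngle.const_mul _
  change MemLp (mulFun (LwPotential m μ w) Ψ) 2 volume
  rw [funext (mulFun_LwPotential m μ w Ψ)]
  exact ((memLp_smul_of_bound (hw2.const_mul 2) hb2 hv).add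
    (memLp_smul_of_bound hw2 hb
      ((memLp_smul_of_bound (Real.measurable_cos.comp hθ).aemeasurable
          (Eventually.of_forall fun x => Real.abs_cos_le_one _) (hT _)).add
        (memLp_smul_of_bound (Real.measurable_sin.comp hθ).aemeasurable
          (Eventually.of_forall fun x => Real.abs_sin_le_one _) (hT _))))).sub
    (hv.const_smul (μ : ℂ))

theorem linearization_domain {m : ℤ} {μ : ℝ} {w : ℝ → ℝ} (hw : IsVortexProfile m μ w) :
    (linearization m μ w).domain = Lc.domain := by
  change Lc.domain ⊓ (Lw m μ w).domain = Lc.domain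
  rw [Lw_domain hw, inf_top_eq]

end GPVortex

end

noncomputable section

/-! ## Compact operators: Riesz splitting -/

section RieszSplitting

variable {H : Type*} [NormedAddCommGroup H] [InnerProductSpace ℂ H]

/-! Everything follows from one compact resolvent of `A`.

Existence (`exists_compact_resolvent`). Let K = (L_c + 1/2)⁻¹ and let V be the bounded operator L_w.
Since J² = -1, t - A = J (1 + B K) (L_c + 1/2) with B = V - 1/2 - tJ. If K is compact, the Fredholm
alternative reduces invertibility of the middle factor to injectivity. The constant matrix J is skew
and commutes with L_c, so Re⟨Ju, L_c u⟩ = 0; a kernel element therefore satisfies t‖u‖² = Re⟨Ju, Vu⟩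
≤ ‖V‖‖u‖², and vanishes for t = ‖V‖ + 1.

Compactness (`isCompactOperator_formEmbedding`). K factors through the embedding of D(q) into L².
The form norm controls ru and ∇u, so the mass at large x and at large frequency is uniformly small.
What remains is a low-frequency function on a ball, uniformly Lipschitz, hence determined up to a
small error by finitely many point values.

Spectrum (`IsResolventAt.spectrum_subset_discreteSpectrum`). With S = (z₀ - A)⁻¹ one has ζ - A = T_ζ
(z₀ - A), where T_ζ = 1 + (ζ - z₀)S. The Riesz splitting of S at the point corresponding to z ∈ σ(A)
isolates the singularity of T_ζ⁻¹ at z on a finite-dimensional invariant subspace. The complementary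
part of the resolvent is holomorphic near z and contributes nothing to the contour integral. -/

theorem ContinuousLinearMap.pow_apply_eq_zero_of_le {T : H →L[ℂ] H} {m n : ℕ} (h : m ≤ n) {x : H}
    (hx : (T ^ m) x = 0) : (T ^ n) x = 0 := by
  obtain ⟨k, rfl⟩ := Nat.exists_eq_add_of_le' h
  rw [pow_add, mul_apply_eq_comp, hx, map_zero]

/-- The ascent of `S - μ` is finite for a compact operator `S` and `μ ≠ 0`. -/
theorem IsCompactOperator.exists_ker_pow_stable {S : H →L[ℂ] H} (hS : IsCompactOperator S)
    {μ : ℂ} (hμ : μ ≠ 0) :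
    ∃ n, ∀ x, ((S - μ • 1) ^ (n + 1) : H →L[ℂ] H) x = 0 → ((S - μ • 1) ^ n : H →L[ℂ] H) x = 0 := by
  set T : H →L[ℂ] H := S - μ • 1 with hT
  have hST : ∀ x, S x = T x + μ • x := fun x => by simp [hT]
  by_contra! h
  -- The kernels of Tⁿ would increase strictly; Riesz's lemma then gives bounded vectors of each
  -- kernel at distance at least 1 from the previous one.
  have key : ∀ n, ∃ x, (T ^ (n + 1)) x = 0 ∧ ‖x‖ ≤ 3 ∧ ∀ y, (T ^ n) y = 0 → 1 ≤ ‖x - y‖ := by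
    intro n
    obtain ⟨x, hx, hx'⟩ := h n
    let E : Submodule ℂ H := (T ^ (n + 1)).ker
    let F : Submodule ℂ E := ((T ^ n).ker).comap E.subtype
    have hF : IsClosed (F : Set E) :=
      (ContinuousLinearMap.isClosed_ker (T ^ n)).preimage continuous_subtype_val
    have hne : ∃ x : E, x ∉ F := ⟨⟨x, hx⟩, hx'⟩
    obtain ⟨x₀, h₁, h₂⟩ := riesz_lemma_of_norm_lt (𝕜 := ℂ) (c := 2) (R := 3) (by norm_num)
      (by norm_num) hF hne
    refine ⟨x₀, x₀.2, h₁, fun y hy => ?_⟩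
    exact h₂ ⟨y, ContinuousLinearMap.pow_apply_eq_zero_of_le n.le_succ hy⟩ hy
  choose x hx hx3 hxd using key
  have hsep : ∀ m n, m < n → ‖μ‖ ≤ ‖S (x n) - S (x m)‖ := by
    intro m n hmn
    -- S x_n - S x_m equals μ (x_n - y) with y this vector of ker Tⁿ, so the images stay ‖μ‖ apart,
    -- which contradicts compactness.
    have hu : (T ^ n) (-μ⁻¹ • (T (x n) - S (x m))) = 0 := by
      have h₁ : (T ^ n) (T (x n)) = 0 := by
        have := hx n
        rwa [pow_succ, mul_apply_eq_comp] at this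
      have h₂ : (T ^ n) (x m) = 0 := ContinuousLinearMap.pow_apply_eq_zero_of_le hmn (hx m)
      have h₃ : (T ^ n) (T (x m)) = 0 := by
        have := ContinuousLinearMap.pow_apply_eq_zero_of_le n.le_succ h₂
        rwa [pow_succ, mul_apply_eq_comp] at this
      rw [map_smul, map_sub, hST, map_add, map_smul, h₁, h₂, h₃]
      simp
    have h := hxd n _ hu
    have he : S (x n) - S (x m) = μ • (x n - -μ⁻¹ • (T (x n) - S (x m))) := by
      rw [smul_sub, smul_smul, mul_neg, mul_inv_cancel₀ hμ, hST (x n)]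
      module
    rw [he, norm_smul]
    exact le_mul_of_one_le_right (norm_nonneg _) h
  obtain ⟨K, hK, hK'⟩ := hS.image_closedBall_subset_compact 3
  obtain ⟨y, -, ψ, hψ, hψy⟩ := hK.tendsto_subseq
    (fun n => hK' ⟨x n, by simpa using hx3 n, rfl⟩)
  obtain ⟨N, hN⟩ := Metric.cauchySeq_iff'.1 hψy.cauchySeq ‖μ‖ (norm_pos_iff.2 hμ)
  have := hN (N + 1) N.le_succ
  rw [dist_eq_norm] at this
  exact absurd this (not_lt.2 (hsep _ _ (hψ N.lt_succ_self)))

/-- For commuting elements a - b divides aⁿ - bⁿ. For compact S this makes (S - μ)ⁿ a scalar plus a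
compact operator. -/
theorem ContinuousLinearMap.exists_sub_smul_one_pow_eq (S : H →L[ℂ] H) (μ : ℂ) (n : ℕ) :
    ∃ Q : H →L[ℂ] H, (S - μ • 1) ^ n = (-μ) ^ n • 1 + S * Q := by
  have hc : Commute (S - μ • 1) (-μ • (1 : H →L[ℂ] H)) := (Commute.one_right _).smul_right _
  obtain ⟨Q, hQ⟩ := hc.sub_dvd_pow_sub_pow n
  have h1 : S - μ • 1 - -μ • (1 : H →L[ℂ] H) = S := by module
  rw [h1, smul_pow, one_pow] at hQ
  exact ⟨Q, by rw [← hQ]; abel⟩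

variable [CompleteSpace H]

/-- Fredholm alternative: an injective compact perturbation of a nonzero scalar is invertible. -/
theorem IsCompactOperator.isUnit_smul_one_add {S : H →L[ℂ] H} (hS : IsCompactOperator S)
    {c : ℂ} (hc : c ≠ 0) (hinj : ∀ x, c • x + S x = 0 → x = 0) : IsUnit (c • 1 + S) := by
  rcases hS.hasEigenvalue_or_mem_resolventSet (neg_ne_zero.2 hc) with h | h
  · obtain ⟨v, hv⟩ := h.exists_hasEigenvector
    refine absurd (hinj v ?_) hv.2
    have : S v = -c • v := hv.apply_eq_smul
    rw [this]
    module
  · rw [spectrum.mem_resolventSet_iff] at h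
    convert h.neg using 1
    rw [Algebra.algebraMap_eq_smul_one]
    module

/-- On the kernel the compact operator -(-μ)⁻ⁿ S Q acts as the identity, and a space with compact
identity is finite-dimensional. -/
theorem IsCompactOperator.finiteDimensional_ker_pow {S : H →L[ℂ] H} (hS : IsCompactOperator S)
    {μ : ℂ} (hμ : μ ≠ 0) (n : ℕ) : FiniteDimensional ℂ ((S - μ • 1) ^ n : H →L[ℂ] H).ker := by
  obtain ⟨Q, hQ⟩ := ContinuousLinearMap.exists_sub_smul_one_pow_eq S μ n
  set N := ((S - μ • 1) ^ n : H →L[ℂ] H).ker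
  have hN : ∀ x ∈ N, (-(((-μ) ^ n)⁻¹ • (S * Q)) : H →L[ℂ] H) x = x := by
    intro x hx
    have h0 : ((S - μ • 1) ^ n) x = 0 := hx
    rw [hQ] at h0
    have h1 : (S * Q) x = -((-μ) ^ n • x) := by
      rw [eq_neg_iff_add_eq_zero, add_comm]
      simpa using h0
    rw [neg_apply, smul_apply, h1, smul_neg, neg_neg,
      smul_smul, inv_mul_cancel₀ (pow_ne_zero _ (neg_ne_zero.2 hμ)), one_smul]
  have hcomp : IsCompactOperator (-(((-μ) ^ n)⁻¹ • (S * Q)) : H →L[ℂ] H) :=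
    ((hS.comp_clm Q).smul (((-μ) ^ n)⁻¹)).neg
  have hmaps : ∀ x ∈ N, ((-(((-μ) ^ n)⁻¹ • (S * Q)) : H →L[ℂ] H) : H →ₗ[ℂ] H) x ∈ N :=
    fun x hx => by
      rw [ContinuousLinearMap.coe_coe, hN x hx]
      exact hx
  have hr := IsCompactOperator.restrict' hcomp hmaps
  have he : ⇑(LinearMap.restrict _ hmaps) = id := funext fun x => Subtype.ext (hN x x.2)
  refine FiniteDimensional.of_isCompactOperator_id (𝕜 := ℂ) ?_
  rwa [he] at hr

/-- Riesz splitting of a compact operator `S` at `μ ≠ 0`: a finite-rank projection `q` commuting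
with `S`, such that `S - μ` is nilpotent on the range of `q` and invertible on its kernel. -/
theorem IsCompactOperator.exists_riesz_splitting {S : H →L[ℂ] H} (hS : IsCompactOperator S)
    {μ : ℂ} (hμ : μ ≠ 0) :
    ∃ q : H →L[ℂ] H, q * q = q ∧ q * S = S * q ∧ FiniteDimensional ℂ q.range ∧
      (∃ n, (S - μ • 1) ^ n * q = 0) ∧ IsUnit ((S - μ • 1) * (1 - q) + q) := by
  obtain ⟨n, hn⟩ := hS.exists_ker_pow_stable hμ
  obtain ⟨Q, hQ⟩ := ContinuousLinearMap.exists_sub_smul_one_pow_eq S μ n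
  have hfd := hS.finiteDimensional_ker_pow hμ n
  set T : H →L[ℂ] H := S - μ • 1 with hT
  have hTS : Commute T S := (Commute.refl S).sub_left ((Commute.one_left S).smul_left μ)
  set N := (T ^ n).ker with hNdef
  have hmemN : ∀ x, x ∈ N ↔ (T ^ n) x = 0 := fun x => Iff.rfl
  have hstable : ∀ k x, (T ^ (n + k)) x = 0 → (T ^ n) x = 0 := by
    intro k
    induction k with
    | zero => exact fun x hx => hx
    | succ k ih =>
      intro x hx
      refine hn x ?_
      rw [pow_succ, mul_apply_eq_comp]
      apply ih
      rwa [← mul_apply_eq_comp, ← pow_succ]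
  let P : H →L[ℂ] H := N.starProjection
  have hPmem : ∀ x, P x ∈ N := fun x => N.starProjection_apply_mem x
  have hPid : ∀ x ∈ N, P x = x := fun x hx => Submodule.starProjection_eq_self_iff.2 hx
  have : ProperSpace N := FiniteDimensional.proper ℂ N
  have hPc : IsCompactOperator P :=
    (isCompactOperator_of_locallyCompactSpace_rng N.subtypeL).comp_clm N.orthogonalProjectionOnto
  -- Adding the orthogonal projection onto N = ker Tⁿ repairs the kernel: if Tⁿx = -Px then T²ⁿx =
  -- 0, so Tⁿx = 0 by stability, and x = Px = 0.
  have hU : IsUnit (T ^ n + P) := by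
    have he : T ^ n + P = (-μ) ^ n • 1 + (S * Q + P) := by rw [hQ]; abel
    rw [he]
    refine IsCompactOperator.isUnit_smul_one_add ((hS.comp_clm Q).add hPc)
      (pow_ne_zero _ (neg_ne_zero.2 hμ)) fun x hx => ?_
    have hx : (T ^ n) x + P x = 0 := by
      have h2 : ((-μ) ^ n • 1 + (S * Q + P)) x = 0 := hx
      rwa [← he] at h2
    have h1 : (T ^ n) x = 0 := by
      apply hstable n
      rw [pow_add, mul_apply_eq_comp, eq_neg_of_add_eq_zero_left hx, map_neg,
        (hmemN _).1 (hPmem x), neg_zero]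
    rw [h1, zero_add, hPid x h1] at hx
    exact hx
  obtain ⟨U, hUe⟩ := hU
  let W : H →L[ℂ] H := ↑U⁻¹
  have hUW : ∀ y, (T ^ n) (W y) + P (W y) = y := by
    intro y
    have : (T ^ n + P) * W = 1 := by rw [← hUe]; exact U.mul_inv
    exact congrArg (fun f : H →L[ℂ] H => f y) this
  have hWU : ∀ y, W ((T ^ n) y + P y) = y := by
    intro y
    have : W * (T ^ n + P) = 1 := by rw [← hUe]; exact U.inv_mul
    exact congrArg (fun f : H →L[ℂ] H => f y) this
  -- Every y is Tⁿ(Wy) + P(Wy), so q is the projection onto N along the range of Tⁿ. It is oblique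
  -- in general, unlike P.
  let q : H →L[ℂ] H := P * W
  have hqN : ∀ x, q x ∈ N := fun x => hPmem _
  have hqid : ∀ x ∈ N, q x = x := by
    intro x hx
    have hW : W x = x := by
      have := hWU x
      rwa [(hmemN x).1 hx, zero_add, hPid x hx] at this
    change P (W x) = x
    rw [hW, hPid x hx]
  -- q(Tⁿx) lies both in N and in the range of Tⁿ; stability of the kernels makes this intersection
  -- trivial.
  have hqran : ∀ x, q ((T ^ n) x) = 0 := by
    intro x
    have h1 : q ((T ^ n) x) = (T ^ n) (x - W ((T ^ n) x)) := by
      rw [map_sub, eq_sub_iff_add_eq, add_comm]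
      exact hUW _
    have h2 := (hmemN _).1 (hqN ((T ^ n) x))
    rw [h1] at h2 ⊢
    rw [← mul_apply_eq_comp, ← pow_add] at h2
    exact hstable n _ h2
  have hqq : q * q = q := by ext x; exact hqid _ (hqN x)
  have hqS : q * S = S * q := by
    ext x
    have h1 : S (q x) ∈ N := by
      have hc : (T ^ n) * S = S * T ^ n := (hTS.pow_left n).eq
      rw [hmemN, ← mul_apply_eq_comp, hc, mul_apply_eq_comp,
        (hmemN _).1 (hqN x), map_zero]
    have h2 : S ((T ^ n) (W x)) = (T ^ n) (S (W x)) := by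
      have hc : (T ^ n) * S = S * T ^ n := (hTS.pow_left n).eq
      rw [← mul_apply_eq_comp, ← hc, mul_apply_eq_comp]
    change q (S x) = S (q x)
    conv_lhs => rw [← hUW x, map_add, h2, map_add, hqran, zero_add]
    exact hqid _ h1
  have hqT : q * T = T * q := by
    rw [hT, mul_sub, sub_mul, hqS, mul_smul_comm, smul_mul_assoc, one_mul, mul_one]
  refine ⟨q, hqq, hqS, ?_, ⟨n, ?_⟩, ?_⟩
  · refine Submodule.finiteDimensional_of_le (S₂ := N) ?_
    rintro _ ⟨x, rfl⟩
    exact hqN x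
  · ext x
    exact hqN x
  · have hqc : IsCompactOperator q := hPc.comp_clm W
    have he : T * (1 - q) + q = -μ • 1 + (S * (1 - q) + (μ + 1) • q) := by
      rw [hT, sub_mul, smul_mul_assoc, one_mul]
      module
    rw [he]
    refine IsCompactOperator.isUnit_smul_one_add
      ((hS.comp_clm (1 - q)).add (hqc.smul (μ + 1))) (neg_ne_zero.2 hμ) fun x hx => ?_
    have hx : (T * (1 - q) + q) x = 0 := by rw [he]; exact hx
    -- Multiplying by q on the left removes the T(1 - q) term.
    have hq0 : q x = 0 := by
      have h1 : q * (T * (1 - q) + q) = q := by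
        rw [mul_add, ← mul_assoc, hqT, mul_assoc, mul_sub, hqq, mul_one, sub_self, mul_zero,
          zero_add]
      have h2 := congrArg q hx
      rw [map_zero, ← mul_apply_eq_comp, h1] at h2
      exact h2
    have hT0 : T x = 0 := by
      simpa [hq0] using hx
    have hxN : x ∈ N := by
      apply hn
      rw [pow_succ, mul_apply_eq_comp, hT0, map_zero]
    rw [← hqid x hxN, hq0]

end RieszSplitting

namespace GPVortex

/-! ## Operators with compact resolvent -/

section CompactResolvent

variable {H : Type*} [NormedAddCommGroup H] [InnerProductSpace ℂ H] [CompleteSpace H]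

omit [CompleteSpace H] in
theorem resolvent_eq {A : H →ₗ.[ℂ] H} {z : ℂ} {S : H →L[ℂ] H} (hS : IsResolventAt A z S) :
    resolvent A z = S :=
  (isResolventAt_resolvent ⟨S, hS⟩).unique hS

-- On the domain, ζ - A = (1 + (ζ - z₀)S)(z₀ - A).
omit [CompleteSpace H] in
theorem IsResolventAt.mul_inverse {A : H →ₗ.[ℂ] H} {z₀ : ℂ} {S : H →L[ℂ] H}
    (hS : IsResolventAt A z₀ S) {ζ : ℂ} (hu : IsUnit (1 + (ζ - z₀) • S)) :
    IsResolventAt A ζ (S * Ring.inverse (1 + (ζ - z₀) • S)) := by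
  set T : H →L[ℂ] H := 1 + (ζ - z₀) • S with hT
  have hTinv : ∀ f, T (Ring.inverse T f) = f := fun f => by
    rw [← mul_apply_eq_comp, Ring.mul_inverse_cancel _ hu]; rfl
  have hinvT : ∀ f, Ring.inverse T (T f) = f := fun f => by
    rw [← mul_apply_eq_comp, Ring.inverse_mul_cancel _ hu]; rfl
  have hTS : ∀ g, T g = g + (ζ - z₀) • S g := fun g => by simp [hT]
  constructor
  · intro f
    obtain ⟨u, hu1, hu2⟩ := hS.1 (Ring.inverse T f)
    refine ⟨u, hu1, ?_⟩
    have h := hTinv f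
    rw [hTS, ← hu1] at h
    nth_rw 1 [← hu2] at h
    rw [← h]
    module
  · intro u
    have h : ζ • (u : H) - A u = T (z₀ • (u : H) - A u) := by
      rw [hTS, hS.2 u]
      module
    rw [mul_apply_eq_comp, h, hinvT, hS.2 u]

/-- If `q` is a projection commuting with the resolvent `S` such that `T_ζ (1 - q) + q`, where
`T_ζ = 1 + (ζ - z₀) S`, is invertible on a closed disk around `z`, then the Riesz integral over its
boundary vanishes on the kernel of `q`. -/
theorem rieszProjection_mul_one_sub {A : H →ₗ.[ℂ] H} {z₀ z : ℂ} {S q : H →L[ℂ] H}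
    (hS : IsResolventAt A z₀ S) (hqq : q * q = q) (hqS : q * S = S * q) {r : ℝ} (hr : 0 < r)
    (hX : ∀ ζ ∈ Metric.closedBall z r, IsUnit ((1 + (ζ - z₀) • S) * (1 - q) + q))
    (hT : ∀ ζ ∈ Metric.sphere z r, IsUnit (1 + (ζ - z₀) • S)) :
    rieszProjection A z r * (1 - q) = 0 := by
  let T : ℂ → H →L[ℂ] H := fun ζ => 1 + (ζ - z₀) • S
  let X : ℂ → H →L[ℂ] H := fun ζ => T ζ * (1 - q) + q
  have hTd : Differentiable ℂ T := by fun_prop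
  have hXd : Differentiable ℂ X := by fun_prop
  have hXinv : ∀ ζ ∈ Metric.closedBall z r,
      DifferentiableAt ℂ (fun ζ => Ring.inverse (X ζ)) ζ := fun ζ hζ => by
    obtain ⟨u, hu⟩ := hX ζ hζ
    have h := (hasFDerivAt_ringInverse (𝕜 := ℂ) u).differentiableAt
    rw [hu] at h
    exact h.comp ζ (hXd ζ)
  have hTinv : ∀ ζ ∈ Metric.sphere z r, ContinuousAt (fun ζ => Ring.inverse (T ζ)) ζ :=
    fun ζ hζ => by
    obtain ⟨u, hu⟩ := hT ζ hζ
    have h := (hasFDerivAt_ringInverse (𝕜 := ℂ) u).differentiableAt.continuousAt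
    rw [hu] at h
    exact ContinuousAt.comp (f := T) h hTd.continuous.continuousAt
  have hres : ∀ ζ ∈ Metric.sphere z r, resolvent A ζ = S * Ring.inverse (T ζ) :=
    fun ζ hζ => resolvent_eq (hS.mul_inverse (hT ζ hζ))
  have hint : CircleIntegrable (resolvent A) z r := by
    refine ContinuousOn.circleIntegrable hr.le ?_
    refine ContinuousOn.congr (fun ζ hζ => ?_) hres
    exact (continuousAt_const.mul (hTinv ζ hζ)).continuousWithinAt
  -- On the range of 1 - q the singular T_ζ⁻¹ may be replaced by X_ζ⁻¹, which is holomorphic on the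
  -- whole disk, so Cauchy's theorem applies.
  have hmul : ∀ ζ ∈ Metric.sphere z r,
      resolvent A ζ * (1 - q) = S * ((1 - q) * Ring.inverse (X ζ)) := by
    intro ζ hζ
    have hqT : q * T ζ = T ζ * q := by
      simp only [T, mul_add, add_mul, mul_one, one_mul, mul_smul_comm, smul_mul_assoc, hqS]
    have hpX : (1 - q) * X ζ = T ζ * (1 - q) := by
      simp only [X, mul_add, mul_sub, sub_mul, one_mul, mul_one, hqq]
      rw [← mul_assoc q, hqT, mul_assoc, hqq]
      abel
    rw [hres ζ hζ, mul_assoc]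
    congr 1
    have hXu := hX ζ (Metric.sphere_subset_closedBall hζ)
    have h1 : T ζ * ((1 - q) * Ring.inverse (X ζ)) = 1 - q := by
      rw [← mul_assoc, ← hpX, mul_assoc, Ring.mul_inverse_cancel _ hXu, mul_one]
    calc Ring.inverse (T ζ) * (1 - q)
        = Ring.inverse (T ζ) * (T ζ * ((1 - q) * Ring.inverse (X ζ))) := by rw [h1]
      _ = (1 - q) * Ring.inverse (X ζ) := by
          rw [← mul_assoc, Ring.inverse_mul_cancel _ (hT ζ hζ), one_mul]
  let R : (H →L[ℂ] H) →L[ℂ] (H →L[ℂ] H) :=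
    (ContinuousLinearMap.mul ℂ (H →L[ℂ] H)).flip (1 - q)
  have hR : ∀ B, R B = B * (1 - q) := fun B => rfl
  have hcomm : (∮ ζ in C(z, r), resolvent A ζ) * (1 - q) =
      ∮ ζ in C(z, r), resolvent A ζ * (1 - q) := by
    rw [← hR, circleIntegral, circleIntegral, ← R.intervalIntegral_comp_comm hint.out]
    simp only [smul_mul_assoc, hR]
  rw [rieszProjection, smul_mul_assoc, hcomm, circleIntegral.integral_congr hr.le hmul,
    DiffContOnCl.circleIntegral_eq_zero hr.le, smul_zero]
  refine DifferentiableOn.diffContOnCl fun ζ hζ => ?_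
  rw [closure_ball z hr.ne'] at hζ
  exact (((hXinv ζ hζ).const_mul (1 - q)).const_mul S).differentiableWithinAt

/-- The spectrum of an operator with compact resolvent is discrete. -/
theorem IsResolventAt.spectrum_subset_discreteSpectrum {A : H →ₗ.[ℂ] H} {z₀ : ℂ}
    {S : H →L[ℂ] H} (hS : IsResolventAt A z₀ S) (hc : IsCompactOperator S) :
    spectrum A ⊆ discreteSpectrum A := by
  intro z hz
  have hne : z - z₀ ≠ 0 := by
    rintro h
    rw [sub_eq_zero] at h
    exact hz (h ▸ ⟨S, hS⟩)
  have hnu : ¬ IsUnit (1 + (z - z₀) • S) := fun hu => hz ⟨_, hS.mul_inverse hu⟩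
  have hunit : ∀ ζ, (∀ x, x + (ζ - z₀) • S x = 0 → x = 0) → IsUnit (1 + (ζ - z₀) • S) := by
    intro ζ h
    have := IsCompactOperator.isUnit_smul_one_add (S := (ζ - z₀) • S) (c := 1)
      (hc.smul (ζ - z₀)) one_ne_zero fun x hx => h x (by simpa using hx)
    rwa [one_smul] at this
  -- If x ≠ 0 is in the kernel of T_z, then u = Sx is the eigenvector.
  have hev : IsEigenvalue A z := by
    have h1 : ¬ ∀ x, x + (z - z₀) • S x = 0 → x = 0 := fun h => hnu (hunit z h)
    push Not at h1
    obtain ⟨x, hx, hx0⟩ := h1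
    obtain ⟨u, hu, hux⟩ := hS.1 x
    rw [← hu, ← hux] at hx
    refine ⟨u, fun h0 => hx0 ?_, ?_⟩
    · have h0' : u = 0 := Subtype.ext h0
      rw [← hux, h0', LinearPMap.map_zero]
      simp
    · rw [← sub_eq_zero, ← neg_eq_zero, ← hx]
      module
  -- Chosen so that T_z = (z - z₀)(S - μ).
  set μ : ℂ := -(z - z₀)⁻¹ with hμ
  have hμ0 : μ ≠ 0 := neg_ne_zero.2 (inv_ne_zero hne)
  obtain ⟨q, hqq, hqS, hqf, ⟨n, hn⟩, hq⟩ := hc.exists_riesz_splitting hμ0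
  have hTz : 1 + (z - z₀) • S = (z - z₀) • (S - μ • 1) := by
    rw [smul_sub, smul_smul, hμ, mul_neg, mul_inv_cancel₀ hne]
    module
  have hXz : IsUnit ((1 + (z - z₀) • S) * (1 - q) + q) := by
    have h1 : IsUnit ((z - z₀) • (1 - q) + q) := by
      have hqp : q * (1 - q) = 0 := by rw [mul_sub, mul_one, hqq, sub_self]
      have hpq : (1 - q) * q = 0 := by rw [sub_mul, one_mul, hqq, sub_self]
      have hpp : (1 - q) * (1 - q) = 1 - q := by rw [sub_mul, one_mul, hqp, sub_zero]
      refine isUnit_iff_exists.2 ⟨(z - z₀)⁻¹ • (1 - q) + q, ?_, ?_⟩ <;>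
      · rw [add_mul, mul_add, mul_add, smul_mul_smul_comm, smul_mul_assoc, mul_smul_comm, hpp, hqp,
          hpq, hqq]
        simp [hne]
    have h2 : (1 + (z - z₀) • S) * (1 - q) + q =
        ((S - μ • 1) * (1 - q) + q) * ((z - z₀) • (1 - q) + q) := by
      rw [hTz]
      simp only [mul_add, add_mul, mul_sub, sub_mul, smul_mul_assoc,
        mul_smul_comm, mul_one, one_mul, hqq, mul_assoc]
      module
    rw [h2]
    exact hq.mul h1
  have hXev : ∀ᶠ ζ in 𝓝 z, IsUnit ((1 + (ζ - z₀) • S) * (1 - q) + q) := by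
    have hcont : Continuous fun ζ : ℂ => (1 + (ζ - z₀) • S) * (1 - q) + q := by fun_prop
    exact hcont.continuousAt.eventually (Units.isOpen.mem_nhds hXz)
  -- A kernel vector of T_ζ must lie in the range of q, where S - μ is nilpotent. But S - μ acts on
  -- it as the scalar (z - z₀)⁻¹ - (ζ - z₀)⁻¹, which is nonzero for ζ ≠ z.
  have hTev : ∀ ζ, ζ ≠ z → IsUnit ((1 + (ζ - z₀) • S) * (1 - q) + q) →
      IsUnit (1 + (ζ - z₀) • S) := by
    intro ζ hζ hX
    refine hunit ζ fun x hx => ?_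
    have hqx : x = q x := by
      have h1 : ((1 + (ζ - z₀) • S) * (1 - q) + q) ((1 - q) x) = 0 := by
        have h2 : ((1 + (ζ - z₀) • S) * (1 - q) + q) * (1 - q) =
            (1 - q) * (1 + (ζ - z₀) • S) := by
          simp only [mul_add, add_mul, mul_sub, sub_mul, smul_mul_assoc,
            mul_smul_comm, mul_one, one_mul, hqq, mul_assoc, hqS]
          module
        rw [← mul_apply_eq_comp, h2, mul_apply_eq_comp]
        have : (1 + (ζ - z₀) • S) x = 0 := by simpa using hx
        rw [this, map_zero]
      obtain ⟨U, hU⟩ := hX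
      have h3 : (1 - q) x = 0 := by
        have h4 := congrArg (fun f : H →L[ℂ] H => f ((1 - q) x)) U.inv_mul
        simp only [mul_apply_eq_comp, hU] at h4
        rw [h1, map_zero] at h4
        exact h4.symm
      exact sub_eq_zero.1 (by simpa using h3)
    by_cases hζ0 : ζ - z₀ = 0
    · simpa [hζ0] using hx
    have hSx : S x = -(ζ - z₀)⁻¹ • x := by
      rw [← inv_smul_smul₀ hζ0 (S x), eq_neg_of_add_eq_zero_right hx, smul_neg, neg_smul]
    have hTx : (S - μ • 1) x = ((z - z₀)⁻¹ - (ζ - z₀)⁻¹) • x := by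
      simp only [sub_apply, smul_apply, one_apply_eq_self, hSx, hμ]
      module
    have hTn : ∀ k, ((S - μ • 1) ^ k : H →L[ℂ] H) x = ((z - z₀)⁻¹ - (ζ - z₀)⁻¹) ^ k • x := by
      intro k
      induction k with
      | zero => simp
      | succ k ih => rw [pow_succ, mul_apply_eq_comp, hTx, map_smul, ih, smul_smul, ← pow_succ']
    have h0 : ((z - z₀)⁻¹ - (ζ - z₀)⁻¹) ^ n • x = 0 := by
      rw [← hTn]
      nth_rw 1 [hqx]
      rw [← mul_apply_eq_comp, hn]
      rfl
    refine (smul_eq_zero.1 h0).resolve_left (pow_ne_zero _ fun h => hζ ?_)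
    have := inv_injective (sub_eq_zero.1 h)
    exact (sub_left_injective this).symm
  refine ⟨⟨hz, ?_⟩, hev, ?_⟩
  · filter_upwards [hXev.filter_mono nhdsWithin_le_nhds, self_mem_nhdsWithin] with ζ h1 h2
    exact ⟨_, hS.mul_inverse (hTev ζ h2 h1)⟩
  · obtain ⟨ε, hε, hball⟩ := Metric.eventually_nhds_iff_ball.1 hXev
    filter_upwards [Ioo_mem_nhdsGT hε] with r hr
    have hX : ∀ ζ ∈ Metric.closedBall z r, IsUnit ((1 + (ζ - z₀) • S) * (1 - q) + q) :=
      fun ζ hζ => hball ζ (Metric.closedBall_subset_ball hr.2 hζ)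
    have h0 := rieszProjection_mul_one_sub hS hqq hqS hr.1 hX fun ζ hζ =>
      hTev ζ (Metric.ne_of_mem_sphere hζ hr.1.ne') (hX ζ (Metric.sphere_subset_closedBall hζ))
    -- The Riesz integral factors through the finite-rank q, so its range is the image of a
    -- finite-dimensional space.
    have hP : rieszProjection A z r = rieszProjection A z r * q := by
      rw [mul_sub, mul_one, sub_eq_zero] at h0
      exact h0
    have hfd : FiniteDimensional ℂ (q.range.map (rieszProjection A z r : H →ₗ[ℂ] H)) :=
      inferInstance
    refine Submodule.finiteDimensional_of_le (S₂ := q.range.map (rieszProjection A z r : H →ₗ[ℂ] H))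
      ?_
    rintro _ ⟨x, rfl⟩
    refine ⟨q x, ⟨x, rfl⟩, ?_⟩
    exact (congrArg (fun f : H →L[ℂ] H => f x) hP).symm

end CompactResolvent

end GPVortex

namespace GPVortex

/-! ## The inverse of `L_c + 1/2` -/

theorem mem_mulOp_graph {M : Plane → Matrix (Fin 2) (Fin 2) ℂ} {u c : L2} :
    (u, c) ∈ (mulOp M).graph ↔ c =ᵐ[volume] mulFun M u := by
  rw [LinearPMap.mem_graph_iff]
  constructor
  · rintro ⟨v, hv, hc⟩
    obtain rfl : (v : L2) = u := hv
    obtain rfl : mulOp M v = c := hc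
    exact MemLp.coeFn_toLp (mem_mulDomain.1 v.2)
  · intro h
    have hu : u ∈ mulDomain M := (Lp.memLp c).ae_eq h
    refine ⟨⟨u, hu⟩, rfl, Lp.ext ?_⟩
    exact (MemLp.coeFn_toLp (mem_mulDomain.1 hu)).trans h.symm

/-- L² convergence gives almost everywhere convergence along a subsequence, and M(x) is continuous
for each fixed x. -/
theorem isClosed_mulOp_graph (M : Plane → Matrix (Fin 2) (Fin 2) ℂ) :
    IsClosed ((mulOp M).graph : Set (L2 × L2)) := by
  refine isSeqClosed_iff_isClosed.1 fun p a hp ha => ?_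
  have h1 : Tendsto (fun n => (p n).1) atTop (𝓝 a.1) := (continuous_fst.tendsto _).comp ha
  have h2 : Tendsto (fun n => (p n).2) atTop (𝓝 a.2) := (continuous_snd.tendsto _).comp ha
  obtain ⟨φ, hφ, hφa⟩ := (tendstoInMeasure_of_tendsto_Lp h1).exists_seq_tendsto_ae
  obtain ⟨χ, hχ, hχa⟩ :=
    (tendstoInMeasure_of_tendsto_Lp (h2.comp hφ.tendsto_atTop)).exists_seq_tendsto_ae
  refine mem_mulOp_graph.2 ?_
  have hall : ∀ᵐ x, ∀ n, (p n).2 x = mulFun M (p n).1 x :=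
    ae_all_iff.2 fun n => mem_mulOp_graph.1 (hp n)
  filter_upwards [hφa, hχa, hall] with x hx1 hx2 hx3
  refine tendsto_nhds_unique hx2 ?_
  have hx4 := ((Matrix.toEuclideanCLM (𝕜 := ℂ) (M x)).continuous.tendsto _).comp
    (hx1.comp hχ.tendsto_atTop)
  refine hx4.congr fun n => ?_
  exact (hx3 _).symm

theorem isClosed_weakPartialGraph (i : Fin 2) :
    IsClosed (weakPartialGraph i : Set (L2 × L2)) := by
  let T := Lp.toTemperedDistributionCLM Pair (volume : Measure Plane) 2
  refine isClosed_eq (f := fun p : L2 × L2 =>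
    ∂_{(EuclideanSpace.single i (1 : ℝ) : Plane)} (T p.1)) (g := fun p : L2 × L2 => T p.2) ?_ ?_
  · exact (ContinuousLineDeriv.continuous_lineDerivOp _).comp (T.continuous.comp continuous_fst)
  · exact T.continuous.comp continuous_snd

/-- Four-tuples of `L²` functions, as a Hilbert space. -/
abbrev L2Quad : Type := PiLp 2 fun _ : Fin 4 => L2

/-- The pair of the components `0` and `i` of a four-tuple. -/
def quadPair (i : Fin 4) : L2Quad →L[ℂ] L2 × L2 :=
  (PiLp.proj 2 (fun _ : Fin 4 => L2) 0).prod (PiLp.proj 2 (fun _ : Fin 4 => L2) i)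

theorem quadPair_apply (i : Fin 4) (p : L2Quad) : quadPair i p = (p 0, p i) := rfl

/-- The `L²` functions `Ψ ∈ D(q)` together with `∂₀Ψ`, `∂₁Ψ` and `rΨ`. -/
def formGraph : Submodule ℂ L2Quad :=
  (weakPartialGraph 0).comap (quadPair 1).toLinearMap ⊓
    ((weakPartialGraph 1).comap (quadPair 2).toLinearMap ⊓
      radiusOp.graph.comap (quadPair 3).toLinearMap)

theorem mem_formGraph {p : L2Quad} : p ∈ formGraph ↔ (p 0, p 1) ∈ weakPartialGraph 0 ∧
    (p 0, p 2) ∈ weakPartialGraph 1 ∧ (p 0, p 3) ∈ radiusOp.graph := by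
  simp only [formGraph, Submodule.mem_inf, Submodule.mem_comap, ContinuousLinearMap.coe_coe,
    quadPair_apply]

theorem isClosed_formGraph : IsClosed (formGraph : Set L2Quad) :=
  ((isClosed_weakPartialGraph 0).preimage (quadPair 1).continuous).inter
    (((isClosed_weakPartialGraph 1).preimage (quadPair 2).continuous).inter
      ((isClosed_mulOp_graph _).preimage (quadPair 3).continuous))

instance : CompleteSpace formGraph := isClosed_formGraph.completeSpace_coe

instance : Inner ℂ formGraph := (Submodule.innerProductSpace formGraph).toInner

theorem mem_formDomain_of_mem_formGraph {p : L2Quad} (hp : p ∈ formGraph) : p 0 ∈ formDomain := by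
  rw [mem_formGraph] at hp
  refine ⟨⟨?_, ?_⟩, LinearPMap.mem_domain_of_mem_graph hp.2.2⟩
  · exact LinearPMap.mem_domain_of_mem_graph (y := p 1) (by rw [weakPartial_graph]; exact hp.1)
  · exact LinearPMap.mem_domain_of_mem_graph (y := p 2) (by rw [weakPartial_graph]; exact hp.2.1)

/-- The lift of `Ψ ∈ D(q)` to `(Ψ, ∂₀Ψ, ∂₁Ψ, rΨ)`. -/
def formLift (Ψ : formDomain) : formGraph :=
  ⟨WithLp.toLp 2 ![(Ψ : L2), weakPartial 0 ⟨Ψ, Ψ.2.1.1⟩, weakPartial 1 ⟨Ψ, Ψ.2.1.2⟩,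
      radiusOp ⟨Ψ, Ψ.2.2⟩],
    by
      refine mem_formGraph.2 ⟨?_, ?_, radiusOp.mem_graph ⟨Ψ, Ψ.2.2⟩⟩
      · rw [← weakPartial_graph]
        exact (weakPartial 0).mem_graph ⟨Ψ, Ψ.2.1.1⟩
      · rw [← weakPartial_graph]
        exact (weakPartial 1).mem_graph ⟨Ψ, Ψ.2.1.2⟩⟩

theorem formLift_apply_zero {p : formGraph} :
    formLift ⟨(p : L2Quad) 0, mem_formDomain_of_mem_formGraph p.2⟩ = p := by
  have h := mem_formGraph.1 p.2
  have h1 := (LinearPMap.mem_graph_iff _).1 (show _ ∈ (weakPartial 0).graph by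
    rw [weakPartial_graph]; exact h.1)
  have h2 := (LinearPMap.mem_graph_iff _).1 (show _ ∈ (weakPartial 1).graph by
    rw [weakPartial_graph]; exact h.2.1)
  have h3 := (LinearPMap.mem_graph_iff _).1 h.2.2
  obtain ⟨⟨u1, _⟩, rfl : u1 = _, h1⟩ := h1
  obtain ⟨⟨u2, _⟩, rfl : u2 = _, h2⟩ := h2
  obtain ⟨⟨u3, _⟩, rfl : u3 = _, h3⟩ := h3
  refine Subtype.ext (PiLp.ext fun i => ?_)
  fin_cases i
  · rfl
  · exact h1
  · exact h2
  · exact h3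

/-- This turns D(q) into a Hilbert space, so that Riesz representation can replace Lax–Milgram. -/
theorem inner_formLift (Φ Ψ : formDomain) :
    inner ℂ (formLift Φ) (formLift Ψ) = 2 * formQ Φ Ψ + inner ℂ (Φ : L2) (Ψ : L2) := by
  rw [Submodule.coe_inner, PiLp.inner_apply, Fin.sum_univ_four, formQ]
  simp only [formLift, Matrix.cons_val]
  ring

/-- The embedding of `D(q)`, with its form norm, into `L²`. -/
def formEmbedding : formGraph →L[ℂ] L2 :=
  (PiLp.proj 2 (fun _ : Fin 4 => L2) 0).comp formGraph.subtypeL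

theorem formEmbedding_formLift (Ψ : formDomain) : formEmbedding (formLift Ψ) = Ψ := rfl

/-- The inverse of `L_c + 1/2`. -/
def halfResolvent : L2 →L[ℂ] L2 :=
  (2 : ℂ) • formEmbedding.comp (ContinuousLinearMap.adjoint formEmbedding)

/-- With E the embedding and u = 2EE*g, the definition of the adjoint reads 2q(Φ, u) + ⟨Φ, u⟩ = 2⟨Φ,
g⟩, which is (L_c + 1/2)u = g in weak form. -/
theorem halfResolvent_mem_LcGraph (g : L2) :
    (halfResolvent g, g - (1 / 2 : ℂ) • halfResolvent g) ∈ LcGraph := by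
  let p : formGraph := (2 : ℂ) • ContinuousLinearMap.adjoint formEmbedding g
  have hp : halfResolvent g = formEmbedding p := by
    simp [halfResolvent, p]
  refine ⟨⟨(p : L2Quad) 0, mem_formDomain_of_mem_formGraph p.2⟩, hp.symm, fun Φ => ?_⟩
  have h := inner_formLift Φ ⟨(p : L2Quad) 0, mem_formDomain_of_mem_formGraph p.2⟩
  rw [formLift_apply_zero] at h
  have h2 : inner ℂ (formLift Φ) p = 2 * inner ℂ (Φ : L2) g :=
    (inner_smul_right (𝕜 := ℂ) (formLift Φ) _ 2).trans (congrArg (2 * ·)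
      (ContinuousLinearMap.adjoint_inner_right formEmbedding (formLift Φ) g))
  have h3 : inner ℂ (Φ : L2) ((p : L2Quad) 0) = inner ℂ (Φ : L2) (halfResolvent g) := by
    rw [hp]; rfl
  rw [h2] at h
  simp only [inner_sub_right, inner_smul_right]
  rw [← h3]
  linear_combination (-1 / 2 : ℂ) * h

/-- L_c d = -d/2 means 2q(d, d) + ‖d‖² = 0, so the form norm of d is zero. -/
theorem eq_zero_of_mem_LcGraph {d : L2} (hd : (d, -(1 / 2 : ℂ) • d) ∈ LcGraph) : d = 0 := by
  obtain ⟨Ψ, rfl : (Ψ : L2) = d, h⟩ := hd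
  have h1 := inner_formLift Ψ Ψ
  rw [h Ψ, inner_smul_right] at h1
  have h2 : inner ℂ (formLift Ψ) (formLift Ψ) = (0 : ℂ) := by
    rw [h1]; ring
  rw [inner_self_eq_zero] at h2
  rw [← formEmbedding_formLift, h2, map_zero]

theorem halfResolvent_apply_of_mem_LcGraph {u h : L2} (hu : (u, h) ∈ LcGraph) :
    halfResolvent (h + (1 / 2 : ℂ) • u) = u := by
  rw [← sub_eq_zero]
  apply eq_zero_of_mem_LcGraph
  have := sub_mem (halfResolvent_mem_LcGraph (h + (1 / 2 : ℂ) • u)) hu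
  convert this using 1
  refine Prod.ext rfl ?_
  simp only [Prod.snd_sub]
  module

end GPVortex

/-! ## Compactness of the embedding of `D(q)` into `L²` -/

/-- An operator dominated, up to an arbitrarily small error, by finite-rank ones is compact. -/
theorem isCompactOperator_of_forall_norm_le {X Y F : Type*} [NormedAddCommGroup X]
    [NormedSpace ℂ X] [NormedAddCommGroup Y] [NormedSpace ℂ Y] [CompleteSpace Y]
    [NormedAddCommGroup F] [NormedSpace ℂ F] [ProperSpace F] (T : X →L[ℂ] Y)
    (h : ∀ ε > 0, ∃ (ι : Type) (_ : Fintype ι) (Φ : X →L[ℂ] (ι → F)) (C : ℝ),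
      ∀ x, ‖T x‖ ≤ ε * ‖x‖ + C * ‖Φ x‖) : IsCompactOperator T := by
  refine (isCompactOperator_iff_isCompact_closure_image_ball (𝕜₁ := ℂ) (𝕜₂ := ℂ)
    (T : X →ₗ[ℂ] Y) one_pos).2 ?_
  refine TotallyBounded.isCompact_of_isClosed ?_ isClosed_closure
  refine TotallyBounded.closure (Metric.totallyBounded_iff.2 fun ε hε => ?_)
  obtain ⟨ι, _, Φ, C, hC⟩ := h (ε / 4) (by positivity)
  have hb : TotallyBounded (Φ '' Metric.ball 0 1) :=
    (Φ.lipschitz.isBounded_image Metric.isBounded_ball).isCompact_closure.totallyBounded.subset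
      subset_closure
  -- A δ-net of the finite-dimensional image of the ball, pulled back to the ball, becomes an ε-net
  -- for `T`; |C| + 1 avoids division by zero.
  obtain ⟨δ, hδ, hCδ⟩ : ∃ δ > 0, |C| * δ ≤ ε / 4 := by
    refine ⟨ε / (4 * (|C| + 1)), by positivity, ?_⟩
    calc |C| * (ε / (4 * (|C| + 1))) ≤ (|C| + 1) * (ε / (4 * (|C| + 1))) := by
          gcongr
          linarith
      _ = ε / 4 := by field_simp
  obtain ⟨s, hs, hsf, hst⟩ := Set.exists_subset_image_finite_and.1
    (Metric.finite_approx_of_totallyBounded hb δ hδ)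
  refine ⟨T '' s, hsf.image _, ?_⟩
  rintro _ ⟨x, hx, rfl⟩
  obtain ⟨_, ⟨y, hy, rfl⟩, hxy⟩ := Set.mem_iUnion₂.1 (hst ⟨x, hx, rfl⟩) |>.imp fun _ h => h
  have hx1 : ‖x‖ < 1 := by simpa using hx
  have hy1 : ‖y‖ < 1 := by simpa using hs hy
  have hd : ‖Φ (x - y)‖ ≤ δ := by
    rw [map_sub, ← dist_eq_norm]
    exact (Metric.mem_ball.1 hxy).le
  refine Set.mem_iUnion₂.2 ⟨T y, ⟨y, hy, rfl⟩, ?_⟩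
  have hC0 : C * ‖Φ (x - y)‖ ≤ |C| * δ := by
    gcongr
    exact le_abs_self C
  rw [Metric.mem_ball, ContinuousLinearMap.coe_coe, dist_eq_norm, ← map_sub]
  calc ‖T (x - y)‖ ≤ ε / 4 * ‖x - y‖ + C * ‖Φ (x - y)‖ := hC _
    _ ≤ ε / 4 * (‖x‖ + ‖y‖) + |C| * δ := by gcongr; exact norm_sub_le _ _
    _ ≤ ε / 4 * (1 + 1) + ε / 4 := by gcongr
    _ < ε := by linarith

namespace GPVortex

/-! ### Fourier transform on L² and the low-frequency cutoff -/

open FourierTransform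

theorem ae_eq_of_forall_integral_schwartz_smul_eq {f g : Plane → Pair}
    (hf : LocallyIntegrable f volume) (hg : LocallyIntegrable g volume)
    (h : ∀ φ : 𝓢(Plane, ℂ), ∫ x, φ x • f x = ∫ x, φ x • g x) : f =ᵐ[volume] g := by
  refine ae_eq_of_integral_contDiff_smul_eq hf hg fun φ hφ hc => ?_
  have hc' : HasCompactSupport (Complex.ofRealCLM ∘ φ) := hc.comp_left rfl
  have hφ' : ContDiff ℝ ∞ (Complex.ofRealCLM ∘ φ) := by fun_prop
  simpa using h (hc'.toSchwartzMap hφ')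

/-- The Plancherel and the integral definitions of the inverse transform agree because both move
onto a Schwartz test function by duality. -/
theorem fourierInv_toLp_ae_eq {f : Plane → Pair} (hf : MemLp f 2 volume)
    (hf1 : Integrable f volume) :
    ((𝓕⁻ (hf.toLp f) : L2) : Plane → Pair) =ᵐ[volume] 𝓕⁻ f := by
  have hcont : Continuous (𝓕⁻ f) :=
    VectorFourier.fourierIntegral_continuous Real.continuous_fourierChar continuous_inner.neg hf1
  refine ae_eq_of_forall_integral_schwartz_smul_eq
    ((Lp.memLp _).locallyIntegrable one_le_two) hcont.locallyIntegrable fun φ => ?_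
  have h1 : ∫ x, φ x • (𝓕⁻ (hf.toLp f) : L2) x = ∫ x, (𝓕⁻ φ) x • f x := by
    rw [← Lp.toTemperedDistribution_apply, ← Lp.fourierInv_toTemperedDistribution_eq,
      TemperedDistribution.fourierInv_apply, Lp.toTemperedDistribution_apply]
    refine integral_congr_ae ?_
    filter_upwards [hf.coeFn_toLp] with x hx
    rw [hx]
  rw [h1, SchwartzMap.fourierInv_coe]
  have hflip : (-innerₗ Plane).flip = -innerₗ Plane := by
    ext x y
    simp [real_inner_comm]
  have := VectorFourier.integral_fourierIntegral_smul_eq_flip (L := -innerₗ Plane)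
    Real.continuous_fourierChar continuous_inner.neg φ.integrable (μ := volume) hf1
  rw [hflip] at this
  exact this

/-- The differentiation rule holds for tempered distributions; testing against Schwartz functions
brings it back to L² functions. -/
theorem fourier_ae_eq_of_mem_weakPartialGraph {i : Fin 2} {u a : L2}
    (h : (u, a) ∈ weakPartialGraph i) :
    ((𝓕 a : L2) : Plane → Pair) =ᵐ[volume]
      fun ξ => (2 * Real.pi * Complex.I * (ξ i : ℂ)) • (𝓕 u : L2) ξ := by
  have hc : Continuous fun ξ : Plane => (2 * Real.pi * Complex.I * (ξ i : ℂ)) := by fun_prop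
  refine ae_eq_of_forall_integral_schwartz_smul_eq ((Lp.memLp _).locallyIntegrable one_le_two)
    (((Lp.memLp (𝓕 u : L2)).locallyIntegrable one_le_two).continuous_smul hc) fun φ => ?_
  have h0 : ∂_{(EuclideanSpace.single i (1 : ℝ) : Plane)} (u : 𝓢'(Plane, Pair)) = a := h
  have h1 := congrArg (fun T => (𝓕 T) φ) h0
  rw [TemperedDistribution.fourier_lineDerivOp_eq, Lp.fourier_toTemperedDistribution_eq,
    Lp.fourier_toTemperedDistribution_eq] at h1
  rw [← Lp.toTemperedDistribution_apply, ← h1]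
  have hg : Function.HasTemperateGrowth
      fun ξ : Plane => ((inner ℝ ξ (EuclideanSpace.single i (1 : ℝ)) : ℝ) : ℂ) := by fun_prop
  let ψ : 𝓢(Plane, ℂ) := SchwartzMap.smulLeftCLM ℂ
    (fun ξ : Plane => ((inner ℝ ξ (EuclideanSpace.single i (1 : ℝ)) : ℝ) : ℂ)) φ
  have hψ : ∀ ξ, ψ ξ = (ξ i : ℂ) * φ ξ := fun ξ => by
    rw [SchwartzMap.smulLeftCLM_apply_apply hg, EuclideanSpace.inner_single_right]
    simp
  change (2 * Real.pi * Complex.I) • Lp.toTemperedDistribution (𝓕 u : L2) ψ = _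
  rw [Lp.toTemperedDistribution_apply, ← integral_smul]
  refine integral_congr_ae (Eventually.of_forall fun ξ => ?_)
  simp only [hψ, smul_smul]
  congr 1
  ring

/-- Cauchy–Schwarz on a set of finite measure, with c the square root of the area of the disk. -/
theorem exists_setIntegral_norm_le (R : ℝ) : ∃ c : ℝ, 0 ≤ c ∧ ∀ g : L2,
    IntegrableOn g (Metric.closedBall 0 R) volume ∧
      ∫ x in Metric.closedBall (0 : Plane) R, ‖g x‖ ≤ c * ‖g‖ := by
  have hfin : IsFiniteMeasure (volume.restrict (Metric.closedBall (0 : Plane) R)) :=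
    ⟨by rw [Measure.restrict_apply_univ]; exact measure_closedBall_lt_top⟩
  refine ⟨(volume (Metric.closedBall (0 : Plane) R)).toReal ^ (1 / 2 : ℝ), by positivity,
    fun g => ?_⟩
  have hg : MemLp g 2 (volume.restrict (Metric.closedBall (0 : Plane) R)) :=
    (Lp.memLp g).restrict _
  have hg1 := hg.integrable one_le_two
  refine ⟨hg1, ?_⟩
  have h := eLpNorm_le_eLpNorm_mul_rpow_measure_univ (p := 1) (q := 2) one_le_two hg.1
  rw [integral_norm_eq_lintegral_enorm hg1.1, ← eLpNorm_one_eq_lintegral_enorm, Lp.norm_def,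
    ENNReal.toReal_rpow, ← ENNReal.toReal_mul, mul_comm]
  refine ENNReal.toReal_mono ?_ (h.trans ?_)
  · exact ENNReal.mul_ne_top (Lp.eLpNorm_ne_top g)
      (ENNReal.rpow_ne_top_of_nonneg (by norm_num) measure_closedBall_lt_top.ne)
  · rw [Measure.restrict_apply_univ]
    gcongr ?_ * ?_
    · exact eLpNorm_mono_measure _ Measure.restrict_le_self
    · norm_num

/-- The low-frequency part `∫_{|ξ| ≤ R} e^{2πi x·ξ} û(ξ) dξ` of `u`. -/
def lowFreq (R : ℝ) (u : L2) : Plane → Pair :=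
  𝓕⁻ ((Metric.closedBall 0 R).indicator (𝓕 u : L2))

theorem lowFreq_apply (R : ℝ) (u : L2) (x : Plane) :
    lowFreq R u x =
      ∫ ξ in Metric.closedBall 0 R, Real.fourierChar (inner ℝ ξ x) • (𝓕 u : L2) ξ := by
  rw [lowFreq, Real.fourierInv_eq, ← integral_indicator measurableSet_closedBall]
  congr 1
  ext1 ξ
  by_cases h : ξ ∈ Metric.closedBall (0 : Plane) R <;> simp [h]

theorem integrableOn_fourierChar_smul (R : ℝ) (x : Plane) (g : L2) :
    IntegrableOn (fun ξ => Real.fourierChar (inner ℝ ξ x) • g ξ) (Metric.closedBall 0 R)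
      volume := by
  obtain ⟨c, -, hc⟩ := exists_setIntegral_norm_le R
  have hcont : Continuous fun ξ : Plane => Real.fourierChar (inner ℝ ξ x) :=
    Real.continuous_fourierChar.comp (continuous_id.inner continuous_const)
  refine Integrable.mono (hc g).1 (hcont.aestronglyMeasurable.smul (hc g).1.1) ?_
  exact Eventually.of_forall fun ξ => (Circle.norm_smul _ _).le

/-- Evaluation of the low-frequency part at a point is a bounded functional. -/
theorem exists_lowFreq_clm (R : ℝ) (x : Plane) :
    ∃ Φ : L2 →L[ℂ] Pair, ∀ u, Φ u = lowFreq R u x := by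
  obtain ⟨c, -, hc⟩ := exists_setIntegral_norm_le R
  let Φ : L2 →ₗ[ℂ] Pair :=
    { toFun := fun u => lowFreq R u x
      map_add' := fun u v => by
        rw [lowFreq_apply, lowFreq_apply, lowFreq_apply, ← integral_add
          (integrableOn_fourierChar_smul R x _) (integrableOn_fourierChar_smul R x _)]
        refine integral_congr_ae (ae_restrict_of_ae ?_)
        rw [FourierTransform.fourier_add]
        filter_upwards [Lp.coeFn_add (𝓕 u : L2) (𝓕 v : L2)] with ξ hξ
        rw [hξ, Pi.add_apply, smul_add]
      map_smul' := fun a u => by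
        rw [lowFreq_apply, lowFreq_apply, RingHom.id_apply, ← integral_smul]
        refine integral_congr_ae (ae_restrict_of_ae ?_)
        rw [FourierTransform.fourier_smul]
        filter_upwards [Lp.coeFn_smul a (𝓕 u : L2)] with ξ hξ
        rw [hξ, Pi.smul_apply, smul_comm] }
  refine ⟨Φ.mkContinuous c fun u => ?_, fun u => rfl⟩
  change ‖lowFreq R u x‖ ≤ _
  rw [lowFreq_apply, ← Lp.norm_fourier_eq u]
  refine (norm_integral_le_integral_norm _).trans (le_of_eq_of_le ?_ (hc (𝓕 u : L2)).2)
  simp only [Circle.norm_smul]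

theorem norm_fourierChar_sub_le (s t : ℝ) :
    ‖(Real.fourierChar s : ℂ) - Real.fourierChar t‖ ≤ 2 * Real.pi * |s - t| := by
  have h1 : (Real.fourierChar s : ℂ) - Real.fourierChar t =
      Real.fourierChar t * (Complex.exp (Complex.I * ((2 * Real.pi * (s - t) : ℝ) : ℂ)) - 1) := by
    rw [Real.fourierChar_apply, Real.fourierChar_apply, mul_sub, ← Complex.exp_add, mul_one]
    congr 2
    push_cast
    ring
  rw [h1, norm_mul, Circle.norm_coe, one_mul]
  refine Real.norm_exp_I_mul_ofReal_sub_one_le.trans (le_of_eq ?_)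
  rw [Real.norm_eq_abs, abs_mul, abs_of_pos (by positivity)]

/-- For |ξ| ≤ R the phase is 2πR-Lipschitz in x, and the L¹ norm of û on this disk is at most c‖u‖
by Plancherel. -/
theorem exists_lowFreq_lipschitz (R : ℝ) (hR : 0 ≤ R) :
    ∃ L : ℝ, 0 ≤ L ∧ ∀ (u : L2) (x y : Plane),
      ‖lowFreq R u x - lowFreq R u y‖ ≤ L * ‖x - y‖ * ‖u‖ := by
  obtain ⟨c, hc0, hc⟩ := exists_setIntegral_norm_le R
  refine ⟨2 * Real.pi * R * c, by positivity, fun u x y => ?_⟩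
  rw [lowFreq_apply, lowFreq_apply, ← integral_sub
    (integrableOn_fourierChar_smul R x _) (integrableOn_fourierChar_smul R y _)]
  have hle : ∀ ξ ∈ Metric.closedBall (0 : Plane) R,
      ‖Real.fourierChar (inner ℝ ξ x) • (𝓕 u : L2) ξ -
        Real.fourierChar (inner ℝ ξ y) • (𝓕 u : L2) ξ‖ ≤
        2 * Real.pi * R * ‖x - y‖ * ‖(𝓕 u : L2) ξ‖ := by
    intro ξ hξ
    rw [Circle.smul_def, Circle.smul_def, ← sub_smul, norm_smul]
    gcongr
    refine (norm_fourierChar_sub_le _ _).trans ?_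
    rw [mul_assoc _ R, ← inner_sub_right]
    gcongr
    exact (abs_real_inner_le_norm _ _).trans (by gcongr; simpa using hξ)
  calc _ ≤ ∫ ξ in Metric.closedBall (0 : Plane) R,
        2 * Real.pi * R * ‖x - y‖ * ‖(𝓕 u : L2) ξ‖ := by
        refine norm_integral_le_of_norm_le ((hc (𝓕 u : L2)).1.norm.const_mul _) ?_
        exact (ae_restrict_iff' measurableSet_closedBall).2 (Eventually.of_forall hle)
    _ ≤ 2 * Real.pi * R * ‖x - y‖ * (c * ‖u‖) := by
        rw [integral_const_mul, ← Lp.norm_fourier_eq u]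
        gcongr
        exact (hc (𝓕 u : L2)).2
    _ = _ := by ring

/-- The `L²` norm is controlled by the form norm at large `x` and large frequencies, and by the
low-frequency part of the function on a ball otherwise. -/
theorem norm_le_of_mem_formGraph {R : ℝ} (hR : 0 < R) : ∃ κ : ℝ, 0 ≤ κ ∧
    ∀ p ∈ formGraph, ∀ b : ℝ, 0 ≤ b → (∀ x ∈ Metric.closedBall (0 : Plane) R,
      ‖lowFreq R (p 0) x‖ ≤ b) → ‖p 0‖ ≤ 2 / R * ‖p‖ + κ * b := by
  let B := Metric.closedBall (0 : Plane) R
  have hB : MeasurableSet B := measurableSet_closedBall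
  have hBfin : volume B ≠ ⊤ := measure_closedBall_lt_top.ne
  refine ⟨‖indicatorConstLp 2 hB hBfin (1 : ℝ)‖, norm_nonneg _, fun p hp b hb0 hb => ?_⟩
  obtain ⟨h0, h1, h2⟩ := mem_formGraph.1 hp
  have hg : MemLp (𝓕 (p 0) : L2) 2 volume := Lp.memLp _
  have hg1 : Integrable (B.indicator (𝓕 (p 0) : L2)) volume := by
    obtain ⟨c, -, hc⟩ := exists_setIntegral_norm_le R
    exact (integrable_indicator_iff hB).2 (hc _).1
  let g1 : L2 := (hg.indicator hB).toLp
  let v : L2 := 𝓕⁻ g1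
  have hv : v =ᵐ[volume] lowFreq R (p 0) := fourierInv_toLp_ae_eq (hg.indicator hB) hg1
  -- By Plancherel only |ξ| > R contributes, and there 2πR ≤ 2π|ξ₀| + 2π|ξ₁|, whose terms are the
  -- symbols of the two derivatives in absolute value.
  have huv : ‖p 0 - v‖ ≤ (2 * Real.pi * R)⁻¹ * (‖p 1‖ + ‖p 2‖) := by
    let a : Lp ℝ 2 (volume : Measure Plane) := (Lp.memLp (𝓕 (p 1) : L2)).norm.toLp
    let a' : Lp ℝ 2 (volume : Measure Plane) := (Lp.memLp (𝓕 (p 2) : L2)).norm.toLp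
    have ha : ‖a‖ = ‖p 1‖ := by
      rw [Lp.norm_toLp, eLpNorm_norm, ← Lp.norm_def, Lp.norm_fourier_eq]
    have ha' : ‖a'‖ = ‖p 2‖ := by
      rw [Lp.norm_toLp, eLpNorm_norm, ← Lp.norm_def, Lp.norm_fourier_eq]
    have hF : ‖p 0 - v‖ = ‖(𝓕 (p 0) : L2) - g1‖ := by
      have hsub : 𝓕 (p 0 - v) = (𝓕 (p 0) : L2) - 𝓕 v :=
        (Lp.fourierTransformₗᵢ Plane Pair).map_sub _ _
      rw [← Lp.norm_fourier_eq, hsub, FourierTransform.fourier_fourierInv_eq]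
    rw [hF, ← ha, ← ha']
    refine (Lp.norm_le_mul_norm_of_ae_le_mul (g := a + a') (c := (2 * Real.pi * R)⁻¹) ?_).trans
      (by gcongr; exact norm_add_le _ _)
    filter_upwards [Lp.coeFn_sub (𝓕 (p 0) : L2) g1, (hg.indicator hB).coeFn_toLp,
      Lp.coeFn_add a a', (Lp.memLp (𝓕 (p 1) : L2)).norm.coeFn_toLp,
      (Lp.memLp (𝓕 (p 2) : L2)).norm.coeFn_toLp, fourier_ae_eq_of_mem_weakPartialGraph h0,
      fourier_ae_eq_of_mem_weakPartialGraph h1] with ξ e1 e2 e3 e4 e5 e6 e7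
    rw [e1, Pi.sub_apply, e2, e3, Pi.add_apply, e4, e5, e6, e7]
    by_cases hξ : ξ ∈ B
    · simp only [Set.indicator_of_mem hξ, sub_self, norm_zero]
      positivity
    · rw [Set.indicator_of_notMem hξ, sub_zero, norm_smul, norm_smul, ← add_mul,
        Real.norm_of_nonneg (by positivity)]
      have hξR : R ≤ ‖ξ‖ := by
        have : ¬ ‖ξ‖ ≤ R := by simpa [B] using hξ
        exact (not_le.1 this).le
      have hle : ‖ξ‖ ≤ |ξ 0| + |ξ 1| := by
        rw [EuclideanSpace.norm_eq, Fin.sum_univ_two]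
        refine Real.sqrt_le_iff.2 ⟨by positivity, ?_⟩
        simp only [Real.norm_eq_abs]
        nlinarith [abs_nonneg (ξ 0), abs_nonneg (ξ 1)]
      have hn : ∀ t : ℝ, ‖(2 * Real.pi * Complex.I * (t : ℂ))‖ = 2 * Real.pi * |t| := fun t => by
        simp [abs_of_pos Real.pi_pos]
      rw [hn, hn, ← mul_add, ← mul_assoc]
      refine le_mul_of_one_le_left (norm_nonneg _) ?_
      rw [inv_mul_eq_div, one_le_div (by positivity)]
      gcongr
      exact hξR.trans hle
  have hu2 : MemLp (p 0) 2 volume := Lp.memLp _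
  let w1 : L2 := (hu2.indicator hB.compl).toLp
  have hw1 : ‖w1‖ ≤ R⁻¹ * ‖p 3‖ := by
    refine Lp.norm_le_mul_norm_of_ae_le_mul ?_
    filter_upwards [(hu2.indicator hB.compl).coeFn_toLp, mem_mulOp_graph.1 h2] with x e1 e2
    rw [e1, e2]
    simp only [mulFun, map_smul, map_one, smul_apply]
    by_cases hx : x ∈ B
    · rw [Set.indicator_of_notMem (by simpa using hx), norm_zero]
      positivity
    · rw [Set.indicator_of_mem (by simpa using hx)]
      have hxR : R ≤ ‖x‖ := by
        have : ¬ ‖x‖ ≤ R := by simpa [B] using hx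
        exact (not_le.1 this).le
      rw [norm_smul, Complex.norm_real, norm_norm, ← mul_assoc]
      refine le_mul_of_one_le_left (norm_nonneg _) ?_
      rw [inv_mul_eq_div, one_le_div hR]
      exact hxR
  let w2 : L2 := ((Lp.memLp (p 0 - v)).indicator hB).toLp
  have hw2 : ‖w2‖ ≤ ‖p 0 - v‖ := by
    refine Lp.norm_le_norm_of_ae_le ?_
    filter_upwards [((Lp.memLp (p 0 - v)).indicator hB).coeFn_toLp] with x e1
    rw [e1]
    exact norm_indicator_le_norm_self _ _
  let w3 : L2 := ((Lp.memLp v).indicator hB).toLp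
  have hw3 : ‖w3‖ ≤ b * ‖indicatorConstLp 2 hB hBfin (1 : ℝ)‖ := by
    refine Lp.norm_le_mul_norm_of_ae_le_mul ?_
    filter_upwards [((Lp.memLp v).indicator hB).coeFn_toLp, hv,
      indicatorConstLp_coeFn (p := 2) (hs := hB) (hμs := hBfin) (c := (1 : ℝ))] with x e1 e2 e3
    rw [e1, e3]
    by_cases hx : x ∈ B
    · rw [Set.indicator_of_mem hx, Set.indicator_of_mem hx, e2, norm_one, mul_one]
      exact hb x hx
    · rw [Set.indicator_of_notMem hx, Set.indicator_of_notMem hx]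
      simp
  -- u = 1_{Bᶜ} u + 1_B (u - v) + 1_B v: the tail in space, the tail in frequency, and the
  -- low-frequency part on the ball.
  have hdec : p 0 = w1 + w2 + w3 := by
    refine Lp.ext ?_
    filter_upwards [Lp.coeFn_add (w1 + w2) w3, Lp.coeFn_add w1 w2,
      (hu2.indicator hB.compl).coeFn_toLp, ((Lp.memLp (p 0 - v)).indicator hB).coeFn_toLp,
      ((Lp.memLp v).indicator hB).coeFn_toLp, Lp.coeFn_sub (p 0) v] with x e1 e2 e3 e4 e5 e6
    rw [e1, Pi.add_apply, e2, Pi.add_apply, e3, e4, e5]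
    by_cases hx : x ∈ B
    · rw [Set.indicator_of_notMem (by simpa using hx), Set.indicator_of_mem hx,
        Set.indicator_of_mem hx, e6, Pi.sub_apply]
      abel
    · rw [Set.indicator_of_mem (by simpa using hx), Set.indicator_of_notMem hx,
        Set.indicator_of_notMem hx]
      simp
  have hp1 : ‖p 1‖ ≤ ‖p‖ := PiLp.norm_apply_le p 1
  have hp2 : ‖p 2‖ ≤ ‖p‖ := PiLp.norm_apply_le p 2
  have hp3 : ‖p 3‖ ≤ ‖p‖ := PiLp.norm_apply_le p 3
  calc ‖p 0‖ ≤ ‖w1‖ + ‖w2‖ + ‖w3‖ := by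
        conv_lhs => rw [hdec]
        exact norm_add₃_le
    _ ≤ R⁻¹ * ‖p‖ + (2 * Real.pi * R)⁻¹ * (‖p‖ + ‖p‖) +
        b * ‖indicatorConstLp 2 hB hBfin (1 : ℝ)‖ := by
        gcongr
        · exact hw1.trans (by gcongr)
        · exact (hw2.trans huv).trans (by gcongr)
    _ ≤ R⁻¹ * ‖p‖ + (2 * R)⁻¹ * (‖p‖ + ‖p‖) +
        b * ‖indicatorConstLp 2 hB hBfin (1 : ℝ)‖ := by
        -- Only π ≥ 1 is needed to reach the total constant 2/R.
        have hpi : 2 * R ≤ 2 * Real.pi * R := by nlinarith [Real.pi_gt_three]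
        gcongr
    _ = _ := by
        field_simp
        ring

theorem isCompactOperator_formEmbedding : IsCompactOperator formEmbedding := by
  refine isCompactOperator_of_forall_norm_le (F := Pair) _ fun ε hε => ?_
  -- The radius 4/ε makes 2/R = ε/2. A net of mesh ε/(2(κL + 1)) makes the Lipschitz error at most
  -- ε/2. The finite-rank map samples the low-frequency part at the net points.
  have hR : 0 < 4 / ε := by positivity
  obtain ⟨κ, hκ, hle⟩ := norm_le_of_mem_formGraph hR
  obtain ⟨L, hL, hlip⟩ := exists_lowFreq_lipschitz (4 / ε) hR.le
  have hδ : 0 < ε / (2 * (κ * L + 1)) := by positivity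
  obtain ⟨t, -, htf, ht⟩ := (isCompact_closedBall (0 : Plane) (4 / ε)).finite_cover_balls hδ
  choose E hE using exists_lowFreq_clm (4 / ε)
  refine ⟨t, htf.fintype, ContinuousLinearMap.pi fun x => (E x).comp formEmbedding, κ,
    fun p => ?_⟩
  let _ := htf.fintype
  set Φ : formGraph →L[ℂ] (t → Pair) :=
    ContinuousLinearMap.pi fun x => (E x).comp formEmbedding with hΦ
  have h := hle p p.2 (‖Φ p‖ + L * (ε / (2 * (κ * L + 1))) * ‖p‖) (by positivity) fun x hx => by
    obtain ⟨y, hy, hxy⟩ := Set.mem_iUnion₂.1 (ht hx)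
    have h1 : ‖lowFreq (4 / ε) ((p : L2Quad) 0) y‖ ≤ ‖Φ p‖ := by
      rw [← hE]
      exact norm_le_pi_norm (Φ p) ⟨y, hy⟩
    have h2 := hlip ((p : L2Quad) 0) x y
    have h3 : ‖x - y‖ ≤ ε / (2 * (κ * L + 1)) := by
      rw [← dist_eq_norm]; exact (Metric.mem_ball.1 hxy).le
    have h4 : ‖(p : L2Quad) 0‖ ≤ ‖p‖ := PiLp.norm_apply_le (p : L2Quad) 0
    calc _ ≤ ‖lowFreq (4 / ε) ((p : L2Quad) 0) y‖ +
          ‖lowFreq (4 / ε) ((p : L2Quad) 0) x - lowFreq (4 / ε) ((p : L2Quad) 0) y‖ :=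
          norm_le_insert' _ _
      _ ≤ ‖Φ p‖ + L * (ε / (2 * (κ * L + 1))) * ‖p‖ := by
          gcongr
          exact h2.trans (by gcongr)
  have hκL : κ * (L * (ε / (2 * (κ * L + 1)))) ≤ ε / 2 := by
    have h5 : κ * (L * (ε / (2 * (κ * L + 1)))) = κ * L / (κ * L + 1) * (ε / 2) := by
      field_simp
    rw [h5]
    refine mul_le_of_le_one_left (by positivity) ?_
    rw [div_le_one (by positivity)]
    linarith
  calc ‖formEmbedding p‖
      ≤ 2 / (4 / ε) * ‖p‖ + κ * (‖Φ p‖ + L * (ε / (2 * (κ * L + 1))) * ‖p‖) := h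
    _ = (ε / 2 + κ * (L * (ε / (2 * (κ * L + 1))))) * ‖p‖ + κ * ‖Φ p‖ := by
        rw [div_div_eq_mul_div]
        ring
    _ ≤ (ε / 2 + ε / 2) * ‖p‖ + κ * ‖Φ p‖ := by gcongr
    _ = _ := by ring

theorem isCompactOperator_halfResolvent : IsCompactOperator halfResolvent :=
  (isCompactOperator_formEmbedding.comp_clm
    (ContinuousLinearMap.adjoint formEmbedding)).smul (2 : ℂ)

end GPVortex

namespace GPVortex

/-! ## The rotation `J` on `D(q)` -/

theorem J_mul_J : J * J = -1 := by
  ext i j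
  fin_cases i <;> fin_cases j <;> simp [J]

theorem star_J : star J = -J := by
  ext i j
  fin_cases i <;> fin_cases j <;> simp [J, Matrix.star_apply]

theorem toEuclideanCLM_J_J (v : Pair) :
    Matrix.toEuclideanCLM (𝕜 := ℂ) J (Matrix.toEuclideanCLM (𝕜 := ℂ) J v) = -v := by
  rw [← mul_apply_eq_comp, ← map_mul, J_mul_J, map_neg, map_one]
  rfl

theorem inner_toEuclideanCLM_J (v w : Pair) :
    inner ℂ (Matrix.toEuclideanCLM (𝕜 := ℂ) J v) w =
      -inner ℂ v (Matrix.toEuclideanCLM (𝕜 := ℂ) J w) := by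
  rw [← ContinuousLinearMap.adjoint_inner_right, ← ContinuousLinearMap.star_eq_adjoint, ← map_star,
    star_J, map_neg, neg_apply, inner_neg_right]

theorem coeFn_opJ (u : L2) :
    opJ u =ᵐ[volume] fun x => Matrix.toEuclideanCLM (𝕜 := ℂ) J (u x) :=
  ContinuousLinearMap.coeFn_compLpL _ u

theorem opJ_opJ (u : L2) : opJ (opJ u) = -u := by
  refine Lp.ext ?_
  filter_upwards [coeFn_opJ (opJ u), coeFn_opJ u, Lp.coeFn_neg u] with x h1 h2 h3
  rw [h1, h2, h3, toEuclideanCLM_J_J, Pi.neg_apply]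

theorem inner_opJ_left (u v : L2) : inner ℂ (opJ u) v = -inner ℂ u (opJ v) := by
  rw [L2.inner_def, L2.inner_def, ← integral_neg]
  refine integral_congr_ae ?_
  filter_upwards [coeFn_opJ u, coeFn_opJ v] with x h1 h2
  rw [h1, h2, inner_toEuclideanCLM_J]

theorem norm_opJ (u : L2) : ‖opJ u‖ = ‖u‖ := by
  have h : inner ℂ (opJ u) (opJ u) = inner ℂ u u := by
    rw [inner_opJ_left, opJ_opJ, inner_neg_right, neg_neg]
  rw [inner_self_eq_norm_sq_to_K, inner_self_eq_norm_sq_to_K] at h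
  have h2 : ‖opJ u‖ ^ 2 = ‖u‖ ^ 2 := by exact_mod_cast h
  exact (sq_eq_sq₀ (norm_nonneg _) (norm_nonneg _)).1 h2

/-- A constant matrix passes through the integral; hence J commutes with weak derivatives. -/
theorem toTemperedDistribution_opJ_apply (u : L2) (φ : 𝓢(Plane, ℂ)) :
    (opJ u : 𝓢'(Plane, Pair)) φ =
      Matrix.toEuclideanCLM (𝕜 := ℂ) J ((u : 𝓢'(Plane, Pair)) φ) := by
  have hint : Integrable (fun x => φ x • u x) volume := by
    rw [← memLp_one_iff_integrable]
    exact (Lp.memLp u).smul (φ.memLp 2 volume)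
  rw [Lp.toTemperedDistribution_apply, Lp.toTemperedDistribution_apply,
    ← ContinuousLinearMap.integral_comp_comm _ hint]
  refine integral_congr_ae ?_
  filter_upwards [coeFn_opJ u] with x hx
  rw [hx, map_smul]

theorem opJ_mem_weakPartialGraph {i : Fin 2} {u a : L2} (h : (u, a) ∈ weakPartialGraph i) :
    (opJ u, opJ a) ∈ weakPartialGraph i := by
  rw [mem_weakPartialGraph] at h ⊢
  ext1 φ
  have h1 := congrArg (fun T : 𝓢'(Plane, Pair) => T φ) h
  simp only [TemperedDistribution.lineDerivOp_apply_apply, Lp.toTemperedDistributionCLM_apply]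
    at h1 ⊢
  rw [toTemperedDistribution_opJ_apply, toTemperedDistribution_opJ_apply, h1]

theorem opJ_mem_radiusOp_graph {u c : L2} (h : (u, c) ∈ radiusOp.graph) :
    (opJ u, opJ c) ∈ radiusOp.graph := by
  refine mem_mulOp_graph.2 ?_
  filter_upwards [mem_mulOp_graph.1 h, coeFn_opJ u, coeFn_opJ c] with x h1 h2 h3
  simp only [mulFun, map_smul, map_one] at h1 ⊢
  rw [h3, h1, h2]
  simp only [smul_apply, one_apply_eq_self, map_smul]

/-- The action of `J` on `D(q)` together with the derivatives. -/
def formGraphJ (p : formGraph) : formGraph :=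
  ⟨WithLp.toLp 2 fun i => opJ ((p : L2Quad) i), by
    obtain ⟨h0, h1, h2⟩ := mem_formGraph.1 p.2
    exact mem_formGraph.2 ⟨opJ_mem_weakPartialGraph h0, opJ_mem_weakPartialGraph h1,
      opJ_mem_radiusOp_graph h2⟩⟩

theorem formEmbedding_formGraphJ (p : formGraph) :
    formEmbedding (formGraphJ p) = opJ (formEmbedding p) := rfl

theorem inner_formGraphJ_left (p p' : formGraph) :
    inner ℂ (formGraphJ p) p' = -inner ℂ p (formGraphJ p') := by
  rw [Submodule.coe_inner, Submodule.coe_inner, PiLp.inner_apply, PiLp.inner_apply,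
    ← Finset.sum_neg_distrib]
  exact Finset.sum_congr rfl fun i _ => inner_opJ_left _ _

theorem re_inner_opJ_self (u : L2) : (inner ℂ (opJ u) u).re = 0 := by
  have h := inner_opJ_left u u
  rw [← inner_conj_symm u] at h
  have := congrArg Complex.re h
  rw [Complex.neg_re, Complex.conj_re] at this
  linarith

theorem re_inner_formGraphJ_self (p : formGraph) : (inner ℂ (formGraphJ p) p).re = 0 := by
  have h := inner_formGraphJ_left p p
  have h' : inner ℂ p (formGraphJ p) = (starRingEnd ℂ) (inner ℂ (formGraphJ p) p) :=
    (inner_conj_symm _ _).symm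
  rw [h'] at h
  have := congrArg Complex.re h
  rw [Complex.neg_re, Complex.conj_re] at this
  linarith

/-- `-J L_c` is skew-symmetric: `⟨Ju, L_c u⟩` is purely imaginary. -/
theorem re_inner_opJ_of_mem_LcGraph {u h : L2} (hu : (u, h) ∈ LcGraph) :
    (inner ℂ (opJ u) h).re = 0 := by
  obtain ⟨Ψ, rfl : (Ψ : L2) = u, hΨ⟩ := hu
  -- The form is tested against JΨ ∈ D(q). Both the graph inner product and the L² inner product of
  -- JΨ with Ψ are purely imaginary, hence so is q(JΨ, Ψ).
  let p := formGraphJ (formLift Ψ)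
  let Φ : formDomain := ⟨(p : L2Quad) 0, mem_formDomain_of_mem_formGraph p.2⟩
  have hΦ : formLift Φ = p := formLift_apply_zero
  have hΦ' : (Φ : L2) = opJ Ψ := rfl
  have h1 := inner_formLift Φ Ψ
  rw [hΦ, hΨ Φ, hΦ'] at h1
  have h2 := congrArg Complex.re h1
  rw [re_inner_formGraphJ_self, Complex.add_re, re_inner_opJ_self] at h2
  simpa using h2.symm

/-! ## The resolvent of the linearized operator -/

/-- The profile is bounded by C on r > 0 and the trigonometric factors by 1; the origin is a null
set. -/
theorem exists_Lw_clm {m : ℤ} {μ : ℝ} {w : ℝ → ℝ} (hw : IsVortexProfile m μ w) :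
    ∃ V : L2 →L[ℂ] L2, ∀ u : (Lw m μ w).domain, Lw m μ w u = V u := by
  have hdom : ∀ u : L2, u ∈ (Lw m μ w).domain := fun u => by
    rw [Lw_domain hw]
    exact Submodule.mem_top
  obtain ⟨C, hC⟩ := hw.exists_bound
  set K : ℝ := 2 * C ^ 2 + C ^ 2 * (‖Matrix.toEuclideanCLM (𝕜 := ℂ) R‖ +
    ‖Matrix.toEuclideanCLM (𝕜 := ℂ) (J * R)‖) + |μ| with hK
  let V : L2 →ₗ[ℂ] L2 :=
    { toFun := fun u => Lw m μ w ⟨u, hdom u⟩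
      map_add' := fun u v => (Lw m μ w).map_add ⟨u, hdom u⟩ ⟨v, hdom v⟩
      map_smul' := fun c u => (Lw m μ w).map_smul c ⟨u, hdom u⟩ }
  refine ⟨V.mkContinuous K fun u => ?_, fun u => rfl⟩
  refine Lp.norm_le_mul_norm_of_ae_le_mul ?_
  have hgraph : (V u : Plane → Pair) =ᵐ[volume] mulFun (LwPotential m μ w) u :=
    mem_mulOp_graph.1 ((Lw m μ w).mem_graph ⟨u, hdom u⟩)
  filter_upwards [hgraph, Measure.ae_ne volume (0 : Plane)] with x hx hx0
  have hCx : |w ‖x‖| ^ 2 ≤ C ^ 2 := by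
    gcongr
    exact hC _ (norm_pos_iff.2 hx0)
  rw [hx, mulFun_LwPotential]
  refine (norm_sub_le _ _).trans ((add_le_add_left (norm_add_le _ _) _).trans ?_)
  rw [norm_smul, norm_smul, norm_smul, Complex.norm_real, Complex.norm_real, Complex.norm_real,
    Real.norm_eq_abs, Real.norm_eq_abs, Real.norm_eq_abs,
    abs_of_nonneg (show 0 ≤ 2 * |w ‖x‖| ^ 2 by positivity),
    abs_of_nonneg (show 0 ≤ |w ‖x‖| ^ 2 by positivity), hK, add_mul, add_mul,
    mul_assoc (C ^ 2), add_mul]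
  gcongr
  refine (norm_add_le _ _).trans ?_
  rw [norm_smul, norm_smul, Complex.norm_real, Complex.norm_real]
  refine add_le_add ?_ ?_
  · exact (mul_le_of_le_one_left (norm_nonneg _) (Real.abs_cos_le_one _)).trans
      (ContinuousLinearMap.le_opNorm _ _)
  · exact (mul_le_of_le_one_left (norm_nonneg _) (Real.abs_sin_le_one _)).trans
      (ContinuousLinearMap.le_opNorm _ _)

theorem exists_linearization_eq {m : ℤ} {μ : ℝ} {w : ℝ → ℝ} (hw : IsVortexProfile m μ w)
    {V : L2 →L[ℂ] L2} (hV : ∀ u : (Lw m μ w).domain, Lw m μ w u = V u) {u h : L2}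
    (hu : (u, h) ∈ LcGraph) :
    ∃ v : (linearization m μ w).domain, (v : L2) = u ∧
      linearization m μ w v = -opJ (h + V u) := by
  rw [← Lc_graph, LinearPMap.mem_graph_iff] at hu
  obtain ⟨v, rfl : (v : L2) = u, rfl : Lc v = h⟩ := hu
  have hd : (v : L2) ∈ (Lw m μ w).domain := by
    rw [Lw_domain hw]
    exact Submodule.mem_top
  refine ⟨⟨v, v.2, hd⟩, rfl, ?_⟩
  rw [← hV ⟨v, hd⟩]
  rfl

theorem exists_mem_LcGraph_of_linearization {m : ℤ} {μ : ℝ} {w : ℝ → ℝ}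
    {V : L2 →L[ℂ] L2} (hV : ∀ u : (Lw m μ w).domain, Lw m μ w u = V u)
    (v : (linearization m μ w).domain) :
    ∃ h, ((v : L2), h) ∈ LcGraph ∧ linearization m μ w v = -opJ (h + V v) := by
  have hd : (v : L2) ∈ Lc.domain ⊓ (Lw m μ w).domain := v.2
  refine ⟨Lc ⟨v, hd.1⟩, ?_, ?_⟩
  · rw [← Lc_graph]
    exact Lc.mem_graph ⟨v, hd.1⟩
  · rw [← hV ⟨v, hd.2⟩]
    rfl

/-- The linearized operator has a compact resolvent. -/
theorem exists_compact_resolvent {m : ℤ} {μ : ℝ} {w : ℝ → ℝ} (hw : IsVortexProfile m μ w) :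
    ∃ (z : ℂ) (S : L2 →L[ℂ] L2), IsResolventAt (linearization m μ w) z S ∧
      IsCompactOperator S := by
  obtain ⟨V, hV⟩ := exists_Lw_clm hw
  let t : ℝ := ‖V‖ + 1
  -- Chosen so that L_c + V - tJ = (L_c + 1/2) + B.
  let B : L2 →L[ℂ] L2 := V - (1 / 2 : ℂ) • 1 - (t : ℂ) • opJ
  have hB : ∀ u, B u = V u - (1 / 2 : ℂ) • u - (t : ℂ) • opJ u := fun u => rfl
  -- Pairing with Ju removes L_c from the real part and leaves t‖u‖² ≤ ‖V‖‖u‖², impossible for u ≠ 0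
  -- since t > ‖V‖.
  have hker : ∀ u h, (u, h) ∈ LcGraph → h + V u = (t : ℂ) • opJ u → u = 0 := by
    intro u h hu he
    have h1 : inner ℂ (opJ u) h + inner ℂ (opJ u) (V u) = (t : ℂ) * (‖u‖ : ℂ) ^ 2 := by
      rw [← inner_add_right, he, inner_smul_right, inner_self_eq_norm_sq_to_K, norm_opJ]
      rfl
    have h2 := congrArg Complex.re h1
    rw [Complex.add_re, re_inner_opJ_of_mem_LcGraph hu, zero_add, ← Complex.ofReal_pow,
      ← Complex.ofReal_mul, Complex.ofReal_re] at h2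
    have h3 : t * ‖u‖ ^ 2 ≤ ‖V‖ * ‖u‖ ^ 2 := by
      rw [← h2]
      refine (Complex.re_le_norm _).trans ((norm_inner_le_norm _ _).trans ?_)
      rw [norm_opJ]
      calc ‖u‖ * ‖V u‖ ≤ ‖u‖ * (‖V‖ * ‖u‖) := by gcongr; exact V.le_opNorm u
        _ = _ := by ring
    have h4 : ‖u‖ ^ 2 ≤ 0 := by
      have : t * ‖u‖ ^ 2 = ‖V‖ * ‖u‖ ^ 2 + ‖u‖ ^ 2 := by simp only [t]; ring
      linarith
    exact norm_eq_zero.1 (pow_eq_zero_iff two_ne_zero |>.1 (le_antisymm h4 (sq_nonneg _)))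
  have hunit : IsUnit ((1 : ℂ) • 1 + B * halfResolvent) := by
    refine IsCompactOperator.isUnit_smul_one_add
      (isCompactOperator_halfResolvent.clm_comp B) one_ne_zero fun g hg => ?_
    have hg : g + B (halfResolvent g) = 0 := by simpa using hg
    have h0 : halfResolvent g = 0 := by
      refine hker _ _ (halfResolvent_mem_LcGraph g) ?_
      rw [hB] at hg
      rw [← sub_eq_zero, ← hg]
      module
    simpa [h0] using hg
  obtain ⟨F, hF⟩ := hunit
  let W : L2 →L[ℂ] L2 := ↑F⁻¹
  have hFW : ∀ f, W f + B (halfResolvent (W f)) = f := fun f => by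
    have h := congrArg (fun T : L2 →L[ℂ] L2 => T f) F.mul_inv
    rw [hF, one_smul] at h
    exact h
  have hWF : ∀ g, W (g + B (halfResolvent g)) = g := fun g => by
    have h := congrArg (fun T : L2 →L[ℂ] L2 => T g) F.inv_mul
    rw [hF, one_smul] at h
    exact h
  -- This is the factorization (t - A)K = J(1 + BK), K being `halfResolvent`. As J⁻¹ = -J, it gives
  -- the resolvent K(1 + BK)⁻¹(-J), compact because K is.
  have hJ : ∀ g, (t : ℂ) • halfResolvent g -
      -opJ (g - (1 / 2 : ℂ) • halfResolvent g + V (halfResolvent g)) =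
        opJ (g + B (halfResolvent g)) := by
    intro g
    simp only [hB, map_add, map_sub, map_smul, opJ_opJ]
    module
  refine ⟨t, halfResolvent * (W * -opJ), ⟨fun f => ?_, fun u => ?_⟩,
    isCompactOperator_halfResolvent.comp_clm _⟩
  · obtain ⟨v, hv, hAv⟩ := exists_linearization_eq hw hV (halfResolvent_mem_LcGraph (W (-opJ f)))
    refine ⟨v, hv, ?_⟩
    rw [hAv, hv, hJ, hFW, map_neg, opJ_opJ, neg_neg]
  · obtain ⟨h, hu, hAu⟩ := exists_mem_LcGraph_of_linearization hV u
    have hK := halfResolvent_apply_of_mem_LcGraph hu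
    have h1 := hJ (h + (1 / 2 : ℂ) • (u : L2))
    rw [hK, add_sub_cancel_right, ← hAu] at h1
    have h2 := hWF (h + (1 / 2 : ℂ) • (u : L2))
    rw [hK] at h2
    rw [h1]
    change halfResolvent (W (-opJ (opJ _))) = _
    rw [opJ_opJ, neg_neg, h2, hK]

end GPVortex

end

theorem proposition4p1 (m : ℤ) (μ : ℝ) (w : ℝ → ℝ) (hw : GPVortex.IsVortexProfile m μ w) :
    (∀ z ∈ GPVortex.spectrum (GPVortex.linearization m μ w),
      GPVortex.IsIsolatedInSpectrum (GPVortex.linearization m μ w) z ∧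
      GPVortex.IsEigenvalue (GPVortex.linearization m μ w) z ∧
      GPVortex.HasFiniteMultiplicity (GPVortex.linearization m μ w) z) ∧
    GPVortex.essentialSpectrum (GPVortex.linearization m μ w) = ∅ := by
  obtain ⟨z₀, S, hS, hc⟩ := GPVortex.exists_compact_resolvent hw
  have h := hS.spectrum_subset_discreteSpectrum hc
  exact ⟨fun z hz => h hz, Set.sdiff_eq_empty.2 h⟩
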